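/- **Model.** Let $\lambda,\mu,\alpha,\beta>0$ and $\theta=\beta/(\alpha+\beta)$. Every day a Poisson($\lambda$) number of customers arrives at a single-server first-come-first-served queue that opens at time $0$ (ties are served in random order). The arrival times are i.i.d. with law $F$ on $[0,\infty)$, the service times are i.i.d. exponential with rate $\mu$, and all of these are independent. Let $Q(t)$ be the number of customers in the system at time $t$. The expected cost of an additional customer who arrives at time $t$ is $\mathbb E_F[C(t)]=\alpha\,\mathbb E_F[W(t)]+\beta\,(t+\mathbb E_F[W(t)])$, where $W(t)$ is her waiting time before service. Let $F$ be a symmetric Nash equilibrium: for some constant $c$, $\mathbb E_F[C(t)]=c$ on the support of $F$ and $\mathbb E_F[C(t)]\ge c$ for all $t\ge 0$. Let $t_a$ and $t_b$ be the infimum and supremum of $\operatorname{supp}(F)\cap(0,\infty)$. **Data and estimator.** Let $0<t_1<\dots<t_m$ be fixed sampling times, and let $\Xi^{(l)}_i$ be the queue length at time $t_i$ on day $l$; the days are independent and follow the above model. From the first $n$ days put $\hat q_n(t_i)=\frac1n\sum_{l\le n}\Xi_i^{(l)}$, $$\hat a_n=\min_{l\le n}\min\{2\le i\le m:\ \Xi^{(l)}_i-\Xi^{(l)}_{i-1}\ge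 1\},\qquad \hat b_n=\max_{l\le n}\max\{1\le i\le m-1:\ \Xi^{(l)}_{i+1}-\Xi^{(l)}_{i}\ge 1\},$$ $\hat{\mathcal T}=\{t_i:\hat a_n\le i\le\hat b_n\}$ (empty if no increase has been observed). For a finite set $\mathcal T$ of sampling times and $t\in\mathcal T$ let $d(t)=d_{\mathcal T}(t)\in\arg\max_{s\in\mathcal T}|s-t|$ (with any fixed tie-breaking rule), and $$\hat\theta_n=\frac1{|\hat{\mathcal T}|}\sum_{t\in\hat{\mathcal T}}-\frac{\hat q_n(t)-\hat q_n(d(t))}{\mu\,(t-d(t))},\qquad d=d_{\hat{\mathcal T}}.$$ **Theorem 2.** Let $\tilde a=\min\{2\le i\le m: t_i>t_a\}$ and $\tilde b=\max\{1\le i\le m-1: t_i<t_b\}$, and suppose that at least two of the sampling times $t_2,\dots,t_{m-1}$ lie in $(t_a,t_b)$, so that $\tilde a<\tilde b$. Let $\mathcal T=\{t_{\tilde a},\dots,t_{\tilde b}\}$ and $d=d_{\mathcal T}$, and for $\tilde a\le i\le\tilde b$ let $$k_i=|\mathcal T|\,(t_i-d(t_i))\,\mu,\qquad g_i=\sum_{j\ne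 i}\frac1{k_j}\mathbf 1_{\{d(t_j)=t_i\}}-\frac1{k_i},$$ where $j$ runs over $\tilde a,\dots,\tilde b$. Let $v(t)=\operatorname{Var}_F[Q(t)]$ and $\rho(s,t)=\operatorname{Cov}_F[Q(s),Q(t)]$. Then each $Q(t_i)$ has a finite second moment and, as $n\to\infty$, $$\sqrt n\,(\hat\theta_n-\theta)\ \xrightarrow{d}\ \mathcal N\Bigl(0,\ \sum_{i=\tilde a}^{\tilde b}g_i^2\,v(t_i)+2\sum_{i=\tilde a}^{\tilde b}\sum_{j=i+1}^{\tilde b}g_ig_j\,\rho(t_i,t_j)\Bigr),$$ where the variance is nonnegative. Moreover, if $t_1<t_a$, $t_b<t_m$ and no sampling time equals $t_a$ or $t_b$, then $\tilde a=\min\{1\le i\le m:t_i\ge t_a\}$ and $\tilde b=\max\{1\le i\le m:t_i\le t_b\}$, so the sums run over all sampling times in $[t_a,t_b]$. -/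

import Mathlib

open MeasureTheory ProbabilityTheory Filter Topology
open scoped NNReal ENNReal

noncomputable section

namespace ArrivalGame

/-! ### One day of the single-server queue -/

/-- The primitive data of one day `ω = (N, X, S)`: the number `N` of customers, the arrival times
`X 0, X 1, …` (only the first `N` are used), and the service times `S 0, S 1, …`, where `S k` is the
service time of the customer who is the `(k+1)`-st to be served. -/
abbrev Day : Type := ℕ × (ℕ → ℝ) × (ℕ → ℝ)

/-- The law of one day: a Poisson number (mean `lam`) of customers, who choose their arrival times
independently from the distribution `F`, and independent exponential service times with
rate `mu`; all of these are independent. -/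
def dayLaw (lam : ℝ≥0) (mu : ℝ) (F : Measure ℝ) : Measure Day :=
  (poissonMeasure lam).prod
    ((Measure.infinitePi fun _ : ℕ => F).prod (Measure.infinitePi fun _ : ℕ => expMeasure mu))

/-- The number of customers who have arrived by time `s` (inclusive). -/
def arrivals (ω : Day) (s : ℝ) : ℕ := ((Finset.range ω.1).filter fun i => ω.2.1 i ≤ s).card

/-- The number of customers who have arrived strictly before time `s`. -/
def arrivalsBefore (ω : Day) (s : ℝ) : ℕ := ((Finset.range ω.1).filter fun i => ω.2.1 i < s).card

/-- The `(k+1)`-st arrival time in increasing order (for `k < N`), i.e. the `(k+1)`-st order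
statistic of the arrival times: the first time by which more than `k` customers have arrived. -/
def arrivalEpoch (ω : Day) (k : ℕ) : ℝ := sInf {s : ℝ | k < arrivals ω s}

/-- `departure ω k` is the departure time of the `k`-th customer under the first-come-first-served
discipline. The server opens at time `0`, which is the meaning of `departure ω 0`. -/
def departure (ω : Day) : ℕ → ℝ
  | 0 => 0
  | k + 1 => max (departure ω k) (arrivalEpoch ω k) + ω.2.2 k

/-- The queue length at time `s`: the number of customers who have arrived by time `s` and
have not departed by time `s` (the customer in service included). -/
def queueLength (ω : Day) (s : ℝ) : ℕ :=
  ((Finset.range (arrivals ω s)).filter fun k => s < departure ω (k + 1)).card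

/-- The waiting time of an additional customer who arrives at time `s`, averaged over her position
among the customers with the same arrival time, who are served in uniformly random order. With `k`
customers ahead of her (`arrivalsBefore ω s ≤ k ≤ arrivals ω s`), she waits from `s` until the
departure of the `k`-th one. -/
def waitingTime (ω : Day) (s : ℝ) : ℝ :=
  (∑ k ∈ Finset.Icc (arrivalsBefore ω s) (arrivals ω s), max (departure ω k - s) 0) /
    ((arrivals ω s : ℝ) - arrivalsBefore ω s + 1)

/-! ### Costs and equilibrium -/

/-- The expected cost of a customer who arrives at time `s` when all others use `F`: `al` per unit
of waiting time and `be` per unit of tardiness (time from opening until her service starts). -/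
def expectedCost (lam : ℝ≥0) (mu al be : ℝ) (F : Measure ℝ) (s : ℝ) : ℝ :=
  al * (∫ ω, waitingTime ω s ∂(dayLaw lam mu F)) +
    be * (s + ∫ ω, waitingTime ω s ∂(dayLaw lam mu F))

/-- `F` is a symmetric Nash equilibrium arrival distribution of the model without early birds
(no arrivals before time `0`) and without closing time: the expected cost is equal to a constant
on the support of `F`, and is nowhere smaller. -/
structure IsNashEquilibrium (lam : ℝ≥0) (mu al be : ℝ) (F : Measure ℝ) : Prop where
  isProbabilityMeasure : IsProbabilityMeasure F
  no_early : F (Set.Iio 0) = 0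
  exists_const : ∃ c : ℝ, (∀ s ∈ F.support, expectedCost lam mu al be F s = c) ∧
    ∀ s : ℝ, 0 ≤ s → c ≤ expectedCost lam mu al be F s

/-- `t_a`: the left end of the part of the support of `F` in `(0, ∞)`. -/
def supportStart (F : Measure ℝ) : ℝ := sInf (F.support ∩ Set.Ioi 0)

/-- `t_b`: the right end of the part of the support of `F` in `(0, ∞)`. -/
def supportEnd (F : Measure ℝ) : ℝ := sSup (F.support ∩ Set.Ioi 0)

/-! ### The estimator

The sampling times are `t 1 < … < t m`, and `Xi l i` is the queue length seen at time `t i` on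
day `l`; the first `n` days are the days `l < n`. -/

/-- The estimated first index of the support: the first index `i ∈ {2, …, m}` such that on one of
the first `n` days the queue length increased between the times `t (i-1)` and `t i`. -/
def aHat (m n : ℕ) (Xi : ℕ → ℕ → ℕ) : ℕ :=
  sInf {i | 2 ≤ i ∧ i ≤ m ∧ ∃ l < n, Xi l (i - 1) + 1 ≤ Xi l i}

/-- The estimated last index of the support: the last index `i ∈ {1, …, m-1}` such that on one of
the first `n` days the queue length increased between the times `t i` and `t (i+1)`. -/
def bHat (m n : ℕ) (Xi : ℕ → ℕ → ℕ) : ℕ :=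
  sSup {i | 1 ≤ i ∧ i + 1 ≤ m ∧ ∃ l < n, Xi l i + 1 ≤ Xi l (i + 1)}

/-- The indices of the sampling times in the estimated support. It is empty as long as no
increase has been observed. -/
def THat (m n : ℕ) (Xi : ℕ → ℕ → ℕ) : Finset ℕ :=
  (Finset.Icc 1 m).filter fun i => aHat m n Xi ≤ i ∧ i ≤ bHat m n Xi

/-- The sample mean of the queue length at the `i`-th sampling time over the first `n` days. -/
def qHat (n : ℕ) (Xi : ℕ → ℕ → ℕ) (i : ℕ) : ℝ := (∑ l ∈ Finset.range n, (Xi l i : ℝ)) / n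

/-- The estimator of `θ` from the pair of sampling times `t i`, `t j`. -/
def pairEstimator (mu : ℝ) (t : ℕ → ℝ) (n : ℕ) (Xi : ℕ → ℕ → ℕ) (i j : ℕ) : ℝ :=
  -((qHat n Xi i - qHat n Xi j) / (mu * (t i - t j)))

/-- `d T i` is the index of a point of `{t j : j ∈ T}` at the largest distance from `t i`,
for each finite index set `T` and each `i ∈ T` (ties are broken in an arbitrary way). -/
def IsFarthestPairing (t : ℕ → ℝ) (d : Finset ℕ → ℕ → ℕ) : Prop :=
  ∀ T : Finset ℕ, ∀ i ∈ T, d T i ∈ T ∧ ∀ j ∈ T, |t j - t i| ≤ |t (d T i) - t i|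

/-- The mean estimator of `θ`: the average of the pair estimators over the farthest-point pairs in
the estimated support. -/
def thetaHat (mu : ℝ) (t : ℕ → ℝ) (d : Finset ℕ → ℕ → ℕ) (m n : ℕ) (Xi : ℕ → ℕ → ℕ) : ℝ :=
  (1 / ((THat m n Xi).card : ℝ)) *
    ∑ i ∈ THat m n Xi, pairEstimator mu t n Xi i (d (THat m n Xi) i)

/-! ### The asymptotic variance -/

/-- `k_i = |T| (t_i - d(t_i)) μ`. -/
def kConst (mu : ℝ) (t : ℕ → ℝ) (d : Finset ℕ → ℕ → ℕ) (T : Finset ℕ) (i : ℕ) : ℝ :=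
  (T.card : ℝ) * (t i - t (d T i)) * mu

/-- `g_i = ∑_{j ≠ i} 1_{d(t_j) = t_i} / k_j - 1 / k_i`. -/
def gWeight (mu : ℝ) (t : ℕ → ℝ) (d : Finset ℕ → ℕ → ℕ) (T : Finset ℕ) (i : ℕ) : ℝ :=
  (∑ j ∈ T.erase i, (1 / kConst mu t d T j) * (if d T j = i then 1 else 0)) -
    1 / kConst mu t d T i

/-- The variance of the queue length at time `s`. -/
def queueVar (lam : ℝ≥0) (mu : ℝ) (F : Measure ℝ) (s : ℝ) : ℝ :=
  variance (fun ω => (queueLength ω s : ℝ)) (dayLaw lam mu F)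

/-- The covariance of the queue lengths at the times `s` and `u`. -/
def queueCov (lam : ℝ≥0) (mu : ℝ) (F : Measure ℝ) (s u : ℝ) : ℝ :=
  covariance (fun ω => (queueLength ω s : ℝ)) (fun ω => (queueLength ω u : ℝ)) (dayLaw lam mu F)

/-- The asymptotic variance for the index range `{a, …, b}`. -/
def asymptVar (lam : ℝ≥0) (mu : ℝ) (F : Measure ℝ) (t : ℕ → ℝ) (d : Finset ℕ → ℕ → ℕ)
    (a b : ℕ) : ℝ :=
  (∑ i ∈ Finset.Icc a b, gWeight mu t d (Finset.Icc a b) i ^ 2 * queueVar lam mu F (t i)) +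
    2 * ∑ i ∈ Finset.Icc a b, ∑ j ∈ Finset.Ioc i b,
      gWeight mu t d (Finset.Icc a b) i * gWeight mu t d (Finset.Icc a b) j *
        queueCov lam mu F (t i) (t j)

/-- The first index `i ∈ {1, …, m}` with `t_a ≤ t i`. -/
def aTilde (F : Measure ℝ) (t : ℕ → ℝ) (m : ℕ) : ℕ :=
  sInf {i | 1 ≤ i ∧ i ≤ m ∧ supportStart F ≤ t i}

/-- The last index `i ∈ {1, …, m}` with `t i ≤ t_b`. -/
def bTilde (F : Measure ℝ) (t : ℕ → ℝ) (m : ℕ) : ℕ :=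
  sSup {i | 1 ≤ i ∧ i ≤ m ∧ t i ≤ supportEnd F}

/-- The first index `i ∈ {2, …, m}` with `t_a < t i`: the first sampling time at which an increase
can be detected. -/
def aLim (F : Measure ℝ) (t : ℕ → ℝ) (m : ℕ) : ℕ :=
  sInf {i | 2 ≤ i ∧ i ≤ m ∧ supportStart F < t i}

/-- The last index `i ∈ {1, …, m-1}` with `t i < t_b`: the last sampling time after which an
increase can be detected. -/
def bLim (F : Measure ℝ) (t : ℕ → ℝ) (m : ℕ) : ℕ :=
  sSup {i | 1 ≤ i ∧ i + 1 ≤ m ∧ t i < supportEnd F}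

end ArrivalGame

end

open ArrivalGame

namespace ArrivalGame

/-! ### Arrivals and departures along a path -/

/-! On the arrival interval the mean queue length is affine in time with slope `-μθ`, so each pair
estimator is unbiased there. The argument combines this fact with almost sure identification of the
index range and the central limit theorem.

Affine mean. By memorylessness every customer present at time `s` contributes mean `1/μ` to the
remaining work, so `E Q(s) = μ E[workload]` for any `F` (`integral_queueLength`). In equilibrium
there are no atoms at positive times, since arriving just before an atom would cost less. Hence the
workload is almost surely the waiting time, and constancy of the cost on the support gives `E W(s) =
(c - βs)/(α + β)`. The support in `(0, ∞)` has no gaps: across a gap the expected wait is convex,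
strictly so at the midpoint, and the midpoint would cost less than `c`
(`IsNashEquilibrium.mem_support_of_mem_Icc`). Thus the affine formula holds at every sampling time
in `(t_a, t_b)`. An atom at `0` is not excluded, which is why only positive times are considered.

Index range. Between sampling times separated from the arrival interval nobody arrives and the queue
cannot grow; across any other pair of consecutive sampling times growth has positive probability, so
it occurs on some day. Almost surely the estimated range is therefore eventually `{a, …, b}`
(`THat_eq_of_increases`).

Limit law. On that event the estimator is the average over days of the i.i.d. variables `∑ g_i
Q(t_i)`, whose mean is `θ` and whose variance expands bilinearly to `asymptVar`. -/

lemma arrivals_mono (ω : Day) {s u : ℝ} (h : s ≤ u) : arrivals ω s ≤ arrivals ω u :=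
  Finset.card_le_card (Finset.monotone_filter_right _ fun _ _ hi => le_trans hi h)

lemma arrivals_le (ω : Day) (s : ℝ) : arrivals ω s ≤ ω.1 := by
  simpa [arrivals] using Finset.card_filter_le (Finset.range ω.1) fun i => ω.2.1 i ≤ s

lemma arrivalsBefore_le_arrivals (ω : Day) (s : ℝ) : arrivalsBefore ω s ≤ arrivals ω s :=
  Finset.card_le_card (Finset.monotone_filter_right _ fun _ _ hi => le_of_lt hi)

lemma arrivals_eq_arrivalsBefore (ω : Day) {s : ℝ} (h : ∀ i, ω.2.1 i ≠ s) :
    arrivals ω s = arrivalsBefore ω s := by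
  simp only [arrivals, arrivalsBefore, fun i => (h i).le_iff_lt]

lemma arrivalsBefore_lt_arrivals (ω : Day) {s : ℝ} {i : ℕ} (hi : i < ω.1) (h : ω.2.1 i = s) :
    arrivalsBefore ω s < arrivals ω s := by
  refine Finset.card_lt_card ⟨Finset.monotone_filter_right _ fun _ _ hi => le_of_lt hi, fun hs => ?_⟩
  have := hs (Finset.mem_filter.2 ⟨Finset.mem_range.2 hi, h.le⟩)
  simp [h] at this

lemma arrivals_congr (ω : Day) {s u : ℝ} (hsu : s ≤ u) (h : ∀ i, ω.2.1 i ∉ Set.Ioc s u) :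
    arrivals ω u = arrivals ω s := by
  unfold arrivals
  congr 1
  refine Finset.filter_congr fun i _ => ⟨fun hi => ?_, fun hi => hi.trans hsu⟩
  by_contra hc
  exact h i ⟨not_le.1 hc, hi⟩

/-- Finitely many arrivals leave a gap to the right of `s`. This right continuity is what makes the
infimum in `arrivalEpoch` attained. -/
lemma eventually_arrivals_right (ω : Day) (s : ℝ) : ∀ᶠ u in 𝓝[>] s, arrivals ω u = arrivals ω s := by
  have h : ∀ i ∈ Finset.range ω.1, ∀ᶠ u in 𝓝[>] s, (ω.2.1 i ≤ u ↔ ω.2.1 i ≤ s) := by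
    intro i _
    rcases le_or_gt (ω.2.1 i) s with hi | hi
    · filter_upwards [self_mem_nhdsWithin] with u hu
      exact iff_of_true (hi.trans (le_of_lt hu)) hi
    · filter_upwards [Ioo_mem_nhdsGT hi] with u hu
      exact iff_of_false (not_le.2 hu.2) (not_le.2 hi)
  filter_upwards [(Finset.eventually_all _).2 h] with u hu
  unfold arrivals
  rw [Finset.filter_congr hu]

/-- Just to the left of `s` nobody arrives, so there are no ties there and both counts have the same
left limit. -/
lemma eventually_arrivals_left (ω : Day) (s : ℝ) : ∀ᶠ u in 𝓝[<] s,
    arrivals ω u = arrivalsBefore ω s ∧ arrivalsBefore ω u = arrivalsBefore ω s := by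
  have h : ∀ i ∈ Finset.range ω.1, ∀ᶠ u in 𝓝[<] s,
      (ω.2.1 i ≤ u ↔ ω.2.1 i < s) ∧ (ω.2.1 i < u ↔ ω.2.1 i < s) := by
    intro i _
    rcases lt_or_ge (ω.2.1 i) s with hi | hi
    · filter_upwards [Ioo_mem_nhdsLT hi] with u hu
      exact ⟨iff_of_true hu.1.le hi, iff_of_true hu.1 hi⟩
    · filter_upwards [self_mem_nhdsWithin] with u hu
      have : u < ω.2.1 i := lt_of_lt_of_le hu hi
      exact ⟨iff_of_false (not_le.2 this) (not_lt.2 hi),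
        iff_of_false (not_lt.2 this.le) (not_lt.2 hi)⟩
  filter_upwards [(Finset.eventually_all _).2 h] with u hu
  unfold arrivals arrivalsBefore
  rw [Finset.filter_congr fun i hi => (hu i hi).1, Finset.filter_congr fun i hi => (hu i hi).2]
  exact ⟨rfl, rfl⟩

lemma lt_arrivals_nonempty (ω : Day) {k : ℕ} (hk : k < ω.1) : {s | k < arrivals ω s}.Nonempty := by
  obtain ⟨M, hM⟩ := (Finset.finite_toSet ((Finset.range ω.1).image ω.2.1)).bddAbove
  refine ⟨M, ?_⟩
  have : arrivals ω M = ω.1 := by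
    unfold arrivals
    rw [Finset.filter_true_of_mem, Finset.card_range]
    intro i hi
    exact hM (by simpa using ⟨i, by simpa using hi, rfl⟩)
  simpa [this] using hk

lemma lt_arrivals_bddBelow (ω : Day) (k : ℕ) : BddBelow {s | k < arrivals ω s} := by
  obtain ⟨M, hM⟩ := (Finset.finite_toSet ((Finset.range ω.1).image ω.2.1)).bddBelow
  refine ⟨M, fun s hs => ?_⟩
  obtain ⟨i, hi⟩ := Finset.card_pos.1 (lt_of_le_of_lt (Nat.zero_le k) hs)
  rw [Finset.mem_filter] at hi
  exact (hM (by simpa using ⟨i, by simpa using hi.1, rfl⟩)).trans hi.2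

/-- The condition `k < N` excludes the infimum of the empty set, whose default value `0` would be
meaningless here. -/
lemma arrivalEpoch_le_iff (ω : Day) {k : ℕ} (hk : k < ω.1) (s : ℝ) :
    arrivalEpoch ω k ≤ s ↔ k < arrivals ω s := by
  refine ⟨fun h => ?_, fun h => csInf_le (lt_arrivals_bddBelow ω k) h⟩
  by_contra hc
  obtain ⟨u, hu, hsu⟩ := ((eventually_arrivals_right ω s).and self_mem_nhdsWithin).exists
  have : u ≤ arrivalEpoch ω k := by
    refine le_csInf (lt_arrivals_nonempty ω hk) fun v hv => ?_
    by_contra hvu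
    have h1 : k < arrivals ω v := hv
    have := arrivals_mono ω (not_le.1 hvu).le
    omega
  exact absurd (this.trans h) (not_le.2 hsu)

lemma arrivalEpoch_le (ω : Day) {k : ℕ} {s : ℝ} (h : k < arrivals ω s) : arrivalEpoch ω k ≤ s :=
  csInf_le (lt_arrivals_bddBelow ω k) h

lemma le_arrivalEpoch (ω : Day) {k : ℕ} {s : ℝ} (hk : k < ω.1) (h : arrivalsBefore ω s ≤ k) :
    s ≤ arrivalEpoch ω k := by
  by_contra hc
  push Not at hc
  obtain ⟨u, hu, hsu⟩ := ((eventually_arrivals_left ω s).and (Ioo_mem_nhdsLT hc)).exists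
  have := (arrivalEpoch_le_iff ω hk u).1 hsu.1.le
  omega

lemma departure_succ_ge (ω : Day) (k : ℕ) : departure ω k + ω.2.2 k ≤ departure ω (k + 1) := by
  simp [departure]

lemma departure_mono (ω : Day) (hS : ∀ k, 0 ≤ ω.2.2 k) : Monotone (departure ω) :=
  monotone_nat_of_le_succ fun k => by linarith [departure_succ_ge ω k, hS k]

/-- Once the customers counted at `s` are all present the server does not idle before having served
them. This bound yields a majorant of the waiting time that is independent of `s`. -/
lemma departure_le (ω : Day) (hS : ∀ k, 0 ≤ ω.2.2 k) {s : ℝ} (hs : 0 ≤ s) {k : ℕ}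
    (hk : k ≤ arrivals ω s) : departure ω k ≤ s + ∑ j ∈ Finset.range k, ω.2.2 j := by
  induction k with
  | zero => simpa [departure] using hs
  | succ k ih =>
    rw [Finset.sum_range_succ, departure, ← add_assoc]
    gcongr
    have := Finset.sum_nonneg fun j (_ : j ∈ Finset.range k) => hS j
    exact max_le (ih (by omega)) (by linarith [arrivalEpoch_le ω hk])

/-- The time until the departure of the last customer who has arrived by time `s`. -/
noncomputable def workload (ω : Day) (s : ℝ) : ℝ := max (departure ω (arrivals ω s) - s) 0

lemma waitingTime_of_no_tie (ω : Day) {s : ℝ} (h : arrivals ω s = arrivalsBefore ω s) :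
    waitingTime ω s = workload ω s := by
  simp [waitingTime, workload, h]

lemma waitingTime_le_of (ω : Day) {s B : ℝ}
    (h : ∀ k ∈ Finset.Icc (arrivalsBefore ω s) (arrivals ω s), max (departure ω k - s) 0 ≤ B) :
    waitingTime ω s ≤ B := by
  have h1 := arrivalsBefore_le_arrivals ω s
  have h2 : (arrivalsBefore ω s : ℝ) ≤ arrivals ω s := by exact_mod_cast h1
  rw [waitingTime, div_le_iff₀ (by linarith)]
  refine (Finset.sum_le_card_nsmul _ _ _ h).trans_eq ?_
  rw [Nat.card_Icc, nsmul_eq_mul, Nat.cast_sub (by omega)]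
  push_cast
  ring

lemma lt_waitingTime_of (ω : Day) {s B : ℝ}
    (h : ∀ k ∈ Finset.Icc (arrivalsBefore ω s) (arrivals ω s), B ≤ max (departure ω k - s) 0)
    (h' : ∃ k ∈ Finset.Icc (arrivalsBefore ω s) (arrivals ω s), B < max (departure ω k - s) 0) :
    B < waitingTime ω s := by
  have h1 := arrivalsBefore_le_arrivals ω s
  have h2 : (arrivalsBefore ω s : ℝ) ≤ arrivals ω s := by exact_mod_cast h1
  rw [waitingTime, lt_div_iff₀ (by linarith)]
  refine lt_of_eq_of_lt ?_ (Finset.sum_lt_sum h h')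
  rw [Finset.sum_const, Nat.card_Icc, nsmul_eq_mul, Nat.cast_sub (by omega)]
  push_cast
  ring

lemma waitingTime_nonneg (ω : Day) (s : ℝ) : 0 ≤ waitingTime ω s := by
  have h2 : (arrivalsBefore ω s : ℝ) ≤ arrivals ω s := by
    exact_mod_cast arrivalsBefore_le_arrivals ω s
  exact div_nonneg (Finset.sum_nonneg fun _ _ => le_max_right _ _) (by linarith)

lemma waitingTime_le (ω : Day) (hS : ∀ k, 0 ≤ ω.2.2 k) {s : ℝ} (hs : 0 ≤ s) :
    waitingTime ω s ≤ ∑ j ∈ Finset.range ω.1, ω.2.2 j := by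
  refine waitingTime_le_of ω fun k hk => max_le ?_ (Finset.sum_nonneg fun j _ => hS j)
  have hk' := (Finset.mem_Icc.1 hk).2
  have h1 := departure_le ω hS hs hk'
  have h2 : ∑ j ∈ Finset.range k, ω.2.2 j ≤ ∑ j ∈ Finset.range ω.1, ω.2.2 j :=
    Finset.sum_le_sum_of_subset_of_nonneg
      (Finset.range_subset_range.2 (hk'.trans (arrivals_le ω s))) fun j _ _ => hS j
  linarith

/-- The left limit of the waiting time, as felt by a customer who arrives at time `s` just before
everybody else who arrives at that time. -/
noncomputable def waitingTimeLeft (ω : Day) (s : ℝ) : ℝ :=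
  max (departure ω (arrivalsBefore ω s) - s) 0

lemma tendsto_waitingTime_left (ω : Day) (s : ℝ) :
    Tendsto (waitingTime ω) (𝓝[<] s) (𝓝 (waitingTimeLeft ω s)) := by
  have h : Tendsto (fun u => max (departure ω (arrivalsBefore ω s) - u) 0) (𝓝[<] s)
      (𝓝 (waitingTimeLeft ω s)) :=
    (Continuous.tendsto (by fun_prop) s).mono_left nhdsWithin_le_nhds
  refine h.congr' ?_
  filter_upwards [eventually_arrivals_left ω s] with u hu
  rw [waitingTime_of_no_tie ω (hu.1.trans hu.2.symm), workload, hu.1]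

lemma waitingTimeLeft_le (ω : Day) (hS : ∀ k, 0 ≤ ω.2.2 k) {k : ℕ} {s : ℝ}
    (hk : arrivalsBefore ω s ≤ k) : waitingTimeLeft ω s ≤ max (departure ω k - s) 0 :=
  max_le_max (by linarith [departure_mono ω hS hk]) le_rfl

lemma waitingTimeLeft_le_waitingTime (ω : Day) (hS : ∀ k, 0 ≤ ω.2.2 k) (s : ℝ) :
    waitingTimeLeft ω s ≤ waitingTime ω s := by
  have h1 := arrivalsBefore_le_arrivals ω s
  by_contra hc
  push Not at hc
  -- If the average were below `waitingTimeLeft`, every averaged term would exceed it, and the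
  -- average would exceed itself.
  refine absurd (lt_waitingTime_of ω (B := waitingTime ω s) ?_ ⟨arrivals ω s, ?_, ?_⟩) (lt_irrefl _)
  · exact fun k hk => hc.le.trans (waitingTimeLeft_le ω hS (Finset.mem_Icc.1 hk).1)
  · simp [h1]
  · exact hc.trans_le (waitingTimeLeft_le ω hS h1)

/-- Standing behind one customer of the same arrival time costs a full positive service. That
customer starts no earlier than `s`, hence departs after `s`, so the positive part does not hide the
difference. -/
lemma waitingTimeLeft_lt_waitingTime (ω : Day) (hS : ∀ k, 0 < ω.2.2 k) {s : ℝ}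
    (h : arrivalsBefore ω s < arrivals ω s) : waitingTimeLeft ω s < waitingTime ω s := by
  refine lt_waitingTime_of ω (fun k hk => waitingTimeLeft_le ω (fun k => (hS k).le)
    (Finset.mem_Icc.1 hk).1) ⟨arrivalsBefore ω s + 1, by simp; omega, ?_⟩
  have h1 := departure_succ_ge ω (arrivalsBefore ω s)
  have h2 := hS (arrivalsBefore ω s)
  have h3 : s < departure ω (arrivalsBefore ω s + 1) := by
    have h4 : s ≤ arrivalEpoch ω (arrivalsBefore ω s) :=
      le_arrivalEpoch ω (h.trans_le (arrivals_le ω s)) le_rfl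
    have h5 := le_max_right (departure ω (arrivalsBefore ω s)) (arrivalEpoch ω (arrivalsBefore ω s))
    rw [departure]
    linarith
  rw [waitingTimeLeft, max_eq_left (by linarith : (0:ℝ) ≤ departure ω (arrivalsBefore ω s + 1) - s)]
  exact max_lt (by linarith) (by linarith)

lemma queueLength_le (ω : Day) (s : ℝ) : queueLength ω s ≤ ω.1 :=
  ((Finset.card_filter_le _ _).trans_eq (Finset.card_range _)).trans (arrivals_le ω s)

lemma queueLength_anti (ω : Day) {s u : ℝ} (hsu : s ≤ u) (h : ∀ i, ω.2.1 i ∉ Set.Ioc s u) :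
    queueLength ω u ≤ queueLength ω s := by
  unfold queueLength
  rw [arrivals_congr ω hsu h]
  exact Finset.card_le_card (Finset.monotone_filter_right _ fun _ _ hi => lt_of_le_of_lt hsu hi)

/-! ### A day with a single customer -/

/-- Days with a single customer are explicit and supply all the events of positive probability
needed below. -/
lemma arrivals_single {ω : Day} (hN : ω.1 = 1) (s : ℝ) :
    arrivals ω s = if ω.2.1 0 ≤ s then 1 else 0 := by
  simp [arrivals, hN, Finset.filter_singleton, apply_ite Finset.card]

lemma arrivalEpoch_single {ω : Day} (hN : ω.1 = 1) : arrivalEpoch ω 0 = ω.2.1 0 := by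
  refine le_antisymm (arrivalEpoch_le ω ?_) (le_of_not_gt fun h => ?_)
  · simp [arrivals_single hN]
  · have := (arrivalEpoch_le_iff ω (k := 0) (by omega) _).1 le_rfl
    rw [arrivals_single hN, if_neg (not_le.2 h)] at this
    omega

lemma departure_single {ω : Day} (hN : ω.1 = 1) (h0 : 0 ≤ ω.2.1 0) :
    departure ω 1 = ω.2.1 0 + ω.2.2 0 := by
  simp [departure, arrivalEpoch_single hN, h0]

/-! ### Measurability -/

/-- Since the index takes countably many values, it may be frozen. The numbers of arrivals enter as
random indices of departures and as random ranges of sums. -/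
lemma measurable_comp_nat {α β : Type*} [MeasurableSpace α] [MeasurableSpace β] {f : α → ℕ}
    {g : ℕ → α → β} (hf : Measurable f) (hg : ∀ k, Measurable (g k)) :
    Measurable fun x => g (f x) x :=
  (measurable_from_prod_countable_right (f := fun p : ℕ × α => g p.1 p.2) hg).comp
    (hf.prodMk measurable_id)

lemma measurable_card_filter {α : Type*} [MeasurableSpace α] {f : α → ℕ} (hf : Measurable f)
    {p : ℕ → α → Prop} [∀ i x, Decidable (p i x)] (hp : ∀ i, MeasurableSet {x | p i x}) :
    Measurable fun x => ((Finset.range (f x)).filter fun i => p i x).card := by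
  refine measurable_comp_nat (g := fun n x => ((Finset.range n).filter fun i => p i x).card) hf
    fun n => ?_
  simp only [Finset.card_filter]
  exact Finset.measurable_fun_sum _ fun i _ => Measurable.ite (hp i) measurable_const
    measurable_const

lemma measurable_arrivals (s : ℝ) : Measurable fun ω => arrivals ω s :=
  measurable_card_filter measurable_fst fun i =>
    measurableSet_le (by fun_prop) measurable_const

lemma measurable_arrivalsBefore (s : ℝ) : Measurable fun ω => arrivalsBefore ω s :=
  measurable_card_filter measurable_fst fun i =>
    measurableSet_lt (by fun_prop) measurable_const

lemma measurable_arrivalEpoch (k : ℕ) : Measurable fun ω => arrivalEpoch ω k := by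
  refine measurable_of_Iic fun x => ?_
  -- For `N ≤ k` the epoch has the default value `0`, which accounts for the second set of the
  -- union.
  have : (fun ω => arrivalEpoch ω k) ⁻¹' Set.Iic x =
      ({ω | k < ω.1} ∩ {ω | k < arrivals ω x}) ∪ ({ω | ω.1 ≤ k} ∩ {_ω | 0 ≤ x}) := by
    ext ω
    rcases lt_or_ge k ω.1 with hk | hk
    · simp [arrivalEpoch_le_iff ω hk, hk, not_le.2 hk]
    · have : {s | k < arrivals ω s} = ∅ :=
        Set.eq_empty_of_forall_notMem fun s (hs : k < arrivals ω s) => by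
          have := arrivals_le ω s
          omega
      simp [arrivalEpoch, this, hk, not_lt.2 hk]
  rw [this]
  exact ((measurableSet_lt measurable_const measurable_fst).inter
    (measurableSet_lt measurable_const (measurable_arrivals x))).union
    ((measurableSet_le measurable_fst measurable_const).inter (MeasurableSet.const _))

lemma measurable_departure (k : ℕ) : Measurable fun ω => departure ω k := by
  induction k with
  | zero => exact measurable_const
  | succ k ih => exact (ih.max (measurable_arrivalEpoch k)).add (by fun_prop)

lemma measurable_queueLength (s : ℝ) : Measurable fun ω => queueLength ω s :=
  measurable_card_filter (measurable_arrivals s) fun k =>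
    measurableSet_lt measurable_const (measurable_departure (k + 1))

lemma measurable_workload (s : ℝ) : Measurable fun ω => workload ω s :=
  measurable_comp_nat (g := fun k ω => max (departure ω k - s) 0) (measurable_arrivals s)
    fun k => ((measurable_departure k).sub_const s).max measurable_const

lemma measurable_waitingTimeLeft (s : ℝ) : Measurable fun ω => waitingTimeLeft ω s :=
  measurable_comp_nat (g := fun k ω => max (departure ω k - s) 0) (measurable_arrivalsBefore s)
    fun k => ((measurable_departure k).sub_const s).max measurable_const

lemma measurable_waitingTime (s : ℝ) : Measurable fun ω => waitingTime ω s := by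
  refine measurable_comp_nat (g := fun a ω =>
    (∑ k ∈ Finset.Icc a (arrivals ω s), max (departure ω k - s) 0) /
      ((arrivals ω s : ℝ) - a + 1)) (measurable_arrivalsBefore s) fun a => ?_
  refine measurable_comp_nat (g := fun b ω =>
    (∑ k ∈ Finset.Icc a b, max (departure ω k - s) 0) /
      ((b : ℝ) - a + 1)) (measurable_arrivals s) fun b => ?_
  exact (Finset.measurable_fun_sum _ fun k _ =>
    ((measurable_departure k).sub_const s).max measurable_const).div_const _

/-! ### The exponential distribution -/

lemma expMeasure_Ioi {r : ℝ} (hr : 0 < r) {x : ℝ} (hx : 0 ≤ x) :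
    expMeasure r (Set.Ioi x) = ENNReal.ofReal (Real.exp (-(r * x))) := by
  have := isProbabilityMeasure_expMeasure hr
  have h := cdf_expMeasure_eq hr x
  rw [if_pos hx, cdf_eq_real] at h
  rw [← ofReal_measureReal, ← Set.compl_Iic, probReal_compl_eq_one_sub measurableSet_Iic, h]
  ring_nf

lemma ae_expMeasure_pos {r : ℝ} (hr : 0 < r) : ∀ᵐ s ∂(expMeasure r), 0 < s := by
  have := isProbabilityMeasure_expMeasure hr
  have h : expMeasure r (Set.Ioi 0) = 1 := by simp [expMeasure_Ioi hr le_rfl]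
  exact (mem_ae_iff_prob_eq_one measurableSet_Ioi).2 h

lemma expMeasure_Ioc_pos {r : ℝ} (hr : 0 < r) {a b : ℝ} (ha : 0 ≤ a) (hab : a < b) :
    0 < expMeasure r (Set.Ioc a b) := by
  rw [pos_iff_ne_zero]
  intro h
  have h1 : expMeasure r (Set.Ioi a) ≤ expMeasure r (Set.Ioc a b) + expMeasure r (Set.Ioi b) := by
    rw [← Set.Ioc_union_Ioi_eq_Ioi hab.le]
    exact measure_union_le _ _
  rw [h, zero_add, expMeasure_Ioi hr ha, expMeasure_Ioi hr (ha.trans hab.le),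
    ENNReal.ofReal_le_ofReal_iff (Real.exp_pos _).le, Real.exp_le_exp] at h1
  nlinarith

/-- `ENNReal.ofReal` truncates, so the integrand is the positive part. For `c ≥ 0` the layer-cake
formula integrates the exponential tail; for `c ≤ 0` the level is passed from the start, with excess
`-c` plus the whole variable. -/
lemma lintegral_expMeasure_excess {r : ℝ} (hr : 0 < r) (c : ℝ) :
    ∫⁻ s, ENNReal.ofReal (s - c) ∂(expMeasure r) =
      ENNReal.ofReal (-c) + ENNReal.ofReal (1 / r) * expMeasure r (Set.Ioi c) := by
  have := isProbabilityMeasure_expMeasure hr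
  have key : ∀ c : ℝ, 0 ≤ c → ∫⁻ s, ENNReal.ofReal (s - c) ∂(expMeasure r) =
      ENNReal.ofReal (1 / r) * expMeasure r (Set.Ioi c) := by
    intro c hc
    have h1 : ∫⁻ s, ENNReal.ofReal (s - c) ∂(expMeasure r) =
        ∫⁻ s, ENNReal.ofReal (max (s - c) 0) ∂(expMeasure r) := by
      refine lintegral_congr fun s => ?_
      rcases le_total (s - c) 0 with h | h
      · rw [max_eq_right h, ENNReal.ofReal_of_nonpos h, ENNReal.ofReal_zero]
      · rw [max_eq_left h]
    rw [h1, lintegral_eq_lintegral_meas_lt (f := fun s => max (s - c) 0) _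
      (ae_of_all _ fun s => le_max_right _ _) (by fun_prop)]
    have h2 : ∫⁻ x in Set.Ioi 0, expMeasure r {s | x < max (s - c) 0} =
        ∫⁻ x in Set.Ioi 0, ENNReal.ofReal (Real.exp (-(r * c)) * Real.exp (-r * x)) := by
      refine setLIntegral_congr_fun measurableSet_Ioi fun x hx => ?_
      have : {s | x < max (s - c) 0} = Set.Ioi (c + x) := by
        ext s
        simp only [Set.mem_ofPred_eq, lt_max_iff, Set.mem_Ioi] at hx ⊢
        constructor
        · rintro (h | h) <;> linarith
        · intro h; left; linarith
      simp only [this]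
      rw [expMeasure_Ioi hr (add_nonneg hc (le_of_lt hx)), ← Real.exp_add]
      ring_nf
    rw [h2, ← ofReal_integral_eq_lintegral_ofReal
      ((integrableOn_exp_mul_Ioi (by linarith) 0).const_mul _) (ae_of_all _ fun x => by positivity),
      integral_const_mul, integral_exp_mul_Ioi (by linarith) 0, expMeasure_Ioi hr hc,
      ← ENNReal.ofReal_mul (by positivity)]
    congr 1
    simp
    field_simp
  rcases le_total 0 c with hc | hc
  · rw [key c hc, ENNReal.ofReal_of_nonpos (neg_nonpos.2 hc), zero_add]
  · have h0 : expMeasure r (Set.Ioi 0) = 1 := by simp [expMeasure_Ioi hr le_rfl]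
    have hc1 : expMeasure r (Set.Ioi c) = 1 :=
      le_antisymm prob_le_one (h0 ▸ measure_mono (Set.Ioi_subset_Ioi hc))
    have h1 : ∫⁻ s, ENNReal.ofReal (s - c) ∂(expMeasure r) =
        ∫⁻ s, ENNReal.ofReal (-c) + ENNReal.ofReal (s - 0) ∂(expMeasure r) := by
      refine lintegral_congr_ae ?_
      filter_upwards [ae_expMeasure_pos hr] with s hs
      rw [← ENNReal.ofReal_add (by linarith) (by linarith)]
      ring_nf
    rw [h1, lintegral_add_left measurable_const, key 0 le_rfl, hc1, h0]
    simp

/-- The memoryless property of the exponential distribution, in the form of a balance between the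
excess over a level before and after the addition of an independent exponential variable. -/
lemma lintegral_excess_add_exp {Ω : Type*} [MeasurableSpace Ω] {P : Measure Ω}
    [IsProbabilityMeasure P] {Y S : Ω → ℝ} (hY : Measurable Y) (hS : Measurable S) {r : ℝ}
    (hr : 0 < r) (hlaw : P.map S = expMeasure r) (hind : IndepFun Y S P) (c : ℝ) :
    ∫⁻ x, ENNReal.ofReal (Y x + S x - c) ∂P =
      ∫⁻ x, ENNReal.ofReal (Y x - c) ∂P + ENNReal.ofReal (1 / r) * P {x | c < Y x + S x} := by
  have := isProbabilityMeasure_expMeasure hr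
  have := Measure.isProbabilityMeasure_map (μ := P) hY.aemeasurable
  have hmap : P.map (fun x => (Y x, S x)) = (P.map Y).prod (expMeasure r) := by
    rw [(indepFun_iff_map_prod_eq_prod_map_map hY.aemeasurable hS.aemeasurable).1 hind, hlaw]
  have h1 : ∫⁻ x, ENNReal.ofReal (Y x + S x - c) ∂P =
      ∫⁻ p, ENNReal.ofReal (p.1 + p.2 - c) ∂((P.map Y).prod (expMeasure r)) := by
    rw [← hmap, lintegral_map (by fun_prop) (by fun_prop)]
  have hset : MeasurableSet {p : ℝ × ℝ | c < p.1 + p.2} :=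
    measurableSet_lt measurable_const (by fun_prop)
  have h2 : P {x | c < Y x + S x} = ((P.map Y).prod (expMeasure r)) {p | c < p.1 + p.2} := by
    rw [← hmap, Measure.map_apply (by fun_prop) hset]
    rfl
  rw [h1, h2, lintegral_prod _ (by fun_prop), Measure.prod_apply hset,
    ← lintegral_const_mul _ (measurable_measure_prodMk_left hset),
    ← lintegral_map (f := fun y => ENNReal.ofReal (y - c)) (by fun_prop) hY,
    ← lintegral_add_left (by fun_prop)]
  refine lintegral_congr fun y => ?_
  -- Given `Y = y`, the level left for `S` is `c - y`, of either sign.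
  have h3 := lintegral_expMeasure_excess hr (c - y)
  have h4 : Prod.mk y ⁻¹' {p : ℝ × ℝ | c < p.1 + p.2} = Set.Ioi (c - y) := by
    ext s
    simp [sub_lt_iff_lt_add']
  rw [h4, ← neg_sub c y, ← h3]
  exact lintegral_congr fun s => by ring_nf

/-! ### The queue length and the workload -/

lemma departure_congr (n : ℕ) (X : ℕ → ℝ) {S S' : ℕ → ℝ} {k : ℕ} (h : ∀ j < k, S j = S' j) :
    departure (n, X, S) k = departure (n, X, S') k := by
  induction k with
  | zero => rfl
  | succ k ih =>
    rw [departure, departure, ih fun j hj => h j (by omega)]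
    exact congrArg₂ _ rfl (h k (by omega))

/-- The start of a service depends only on the earlier service times. -/
lemma indepFun_service (mu : ℝ) (hmu : 0 < mu) (n : ℕ) (X : ℕ → ℝ) (k : ℕ) :
    IndepFun (fun S : ℕ → ℝ => max (departure (n, X, S) k) (arrivalEpoch (n, X, S) k))
      (fun S => S k) (Measure.infinitePi fun _ : ℕ => expMeasure mu) := by
  have := isProbabilityMeasure_expMeasure hmu
  have hi : iIndepFun (fun i (S : ℕ → ℝ) => S i) (Measure.infinitePi fun _ : ℕ => expMeasure mu) :=
    iIndepFun_infinitePi (X := fun _ => id) fun _ => measurable_id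
  have hfin := hi.indepFun_finset (Finset.range k) {k} (by simp) fun i => measurable_pi_apply i
  -- Padding the first `k` service times by zeros exhibits the start of service as a function of
  -- these alone.
  let ext : (Finset.range k → ℝ) → ℕ → ℝ := fun v j => if h : j ∈ Finset.range k then v ⟨j, h⟩ else 0
  have hext : Measurable ext := by
    refine measurable_pi_lambda _ fun j => ?_
    by_cases h : j ∈ Finset.range k
    · simpa only [ext, h, dite_true] using measurable_pi_apply _
    · simpa only [ext, h, dite_false] using measurable_const
  have hm : Measurable fun v => max (departure (n, X, ext v) k) (arrivalEpoch (n, X, ext v) k) :=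
    ((measurable_departure k).max (measurable_arrivalEpoch k)).comp
      (measurable_const.prodMk (measurable_const.prodMk hext))
  have := hfin.comp hm (measurable_pi_apply (⟨k, by simp⟩ : ({k} : Finset ℕ)))
  refine this.congr (ae_of_all _ fun S => ?_) (ae_of_all _ fun S => rfl)
  simp only [Function.comp_apply]
  congr 1
  refine departure_congr n X fun j hj => ?_
  simp [ext, hj]

/-- Each induction step adds one service and applies the memoryless balance. Since the customer has
arrived by `s`, the excess over `s` of her service start equals that of the previous departure. The
service times `0` in the hypothesis are a dummy: arrivals ignore them. -/
lemma lintegral_excess_departure {mu : ℝ} (hmu : 0 < mu) {s : ℝ} (hs : 0 ≤ s) (n : ℕ) (X : ℕ → ℝ)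
    {k : ℕ} (hk : k ≤ arrivals (n, X, 0) s) :
    ∫⁻ S, ENNReal.ofReal (departure (n, X, S) k - s) ∂(Measure.infinitePi fun _ => expMeasure mu) =
      ENNReal.ofReal (1 / mu) * ∑ j ∈ Finset.range k,
        (Measure.infinitePi fun _ => expMeasure mu) {S | s < departure (n, X, S) (j + 1)} := by
  have := isProbabilityMeasure_expMeasure hmu
  induction k with
  | zero => simp [departure, hs]
  | succ k ih =>
    have hsec : Measurable fun S : ℕ → ℝ => ((n, X, S) : Day) := by fun_prop
    have h := lintegral_excess_add_exp
      (P := Measure.infinitePi fun _ : ℕ => expMeasure mu)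
      (Y := fun S => max (departure (n, X, S) k) (arrivalEpoch (n, X, S) k)) (S := fun S => S k)
      (((measurable_departure k).max (measurable_arrivalEpoch k)).comp hsec)
      (measurable_pi_apply k) hmu (Measure.infinitePi_map_eval _ k) (indepFun_service mu hmu n X k) s
    rw [Finset.sum_range_succ, mul_add, ← ih (by omega)]
    refine h.trans (congrArg₂ _ (lintegral_congr fun S => ?_) rfl)
    have he : arrivalEpoch (n, X, S) k ≤ s := arrivalEpoch_le (n, X, S) hk
    rcases le_total (arrivalEpoch (n, X, S) k) (departure (n, X, S) k) with h1 | h1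
    · rw [max_eq_left h1]
    · rw [max_eq_right h1, ENNReal.ofReal_of_nonpos (by linarith),
        ENNReal.ofReal_of_nonpos (by linarith)]

/-- With `N` and the arrival times fixed, take `k` to be the number of arrivals by `s`: the sum of
probabilities that a departure is after `s` is then the mean queue length. -/
lemma lintegral_workload {mu : ℝ} (hmu : 0 < mu) {s : ℝ} (hs : 0 ≤ s) (lam : ℝ≥0) (F : Measure ℝ)
    [IsProbabilityMeasure F] :
    ∫⁻ ω, ENNReal.ofReal (workload ω s) ∂(dayLaw lam mu F) =
      ENNReal.ofReal (1 / mu) * ∫⁻ ω, (queueLength ω s : ℝ≥0∞) ∂(dayLaw lam mu F) := by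
  have := isProbabilityMeasure_expMeasure hmu
  have mW : Measurable fun ω => ENNReal.ofReal (workload ω s) :=
    (measurable_workload s).ennreal_ofReal
  have mQ : Measurable fun ω => (queueLength ω s : ℝ≥0∞) :=
    (measurable_from_nat (f := fun n : ℕ => (n : ℝ≥0∞))).comp (measurable_queueLength s)
  unfold dayLaw
  rw [lintegral_prod _ mW.aemeasurable, lintegral_prod _ mQ.aemeasurable,
    ← lintegral_const_mul _ mQ.lintegral_prod_right']
  refine lintegral_congr fun n => ?_
  have mWn : Measurable fun p : (ℕ → ℝ) × (ℕ → ℝ) => ENNReal.ofReal (workload (n, p) s) :=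
    mW.comp measurable_prodMk_left
  have mQn : Measurable fun p : (ℕ → ℝ) × (ℕ → ℝ) => (queueLength (n, p) s : ℝ≥0∞) :=
    mQ.comp measurable_prodMk_left
  rw [lintegral_prod _ mWn.aemeasurable, lintegral_prod _ mQn.aemeasurable,
    ← lintegral_const_mul _ mQn.lintegral_prod_right']
  refine lintegral_congr fun X => ?_
  have hsec : Measurable fun S : ℕ → ℝ => ((n, X, S) : Day) := by fun_prop
  have hset : ∀ j, MeasurableSet {S | s < departure (n, X, S) (j + 1)} := fun j =>
    measurableSet_lt measurable_const ((measurable_departure (j + 1)).comp hsec)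
  have hQ : ∫⁻ S, (queueLength (n, X, S) s : ℝ≥0∞) ∂(Measure.infinitePi fun _ => expMeasure mu) =
      ∑ j ∈ Finset.range (arrivals (n, X, 0) s),
        (Measure.infinitePi fun _ => expMeasure mu) {S | s < departure (n, X, S) (j + 1)} := by
    have : ∀ S, (queueLength (n, X, S) s : ℝ≥0∞) = ∑ j ∈ Finset.range (arrivals (n, X, 0) s),
        {S | s < departure (n, X, S) (j + 1)}.indicator 1 S := by
      intro S
      simp only [queueLength, Finset.card_filter, Nat.cast_sum, Nat.cast_ite, Nat.cast_one,
        Nat.cast_zero, Set.indicator_apply, Set.mem_ofPred_eq, Pi.one_apply]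
      rfl
    simp_rw [this]
    rw [lintegral_finsetSum _ fun j _ => measurable_one.indicator (hset j)]
    exact Finset.sum_congr rfl fun j _ => lintegral_indicator_one (hset j)
  rw [hQ, ← lintegral_excess_departure hmu hs n X le_rfl]
  refine lintegral_congr fun S => ?_
  change ENNReal.ofReal (max (departure (n, X, S) (arrivals (n, X, 0) s) - s) 0) = _
  rcases le_total (departure (n, X, S) (arrivals (n, X, 0) s) - s) 0 with h | h
  · rw [max_eq_right h, ENNReal.ofReal_of_nonpos h, ENNReal.ofReal_zero]
  · rw [max_eq_left h]

lemma integral_queueLength {mu : ℝ} (hmu : 0 < mu) {s : ℝ} (hs : 0 ≤ s) (lam : ℝ≥0) (F : Measure ℝ)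
    [IsProbabilityMeasure F] :
    ∫ ω, (queueLength ω s : ℝ) ∂(dayLaw lam mu F) = mu * ∫ ω, workload ω s ∂(dayLaw lam mu F) := by
  have mQ : Measurable fun ω => (queueLength ω s : ℝ) :=
    (measurable_from_nat (f := fun n : ℕ => (n : ℝ))).comp (measurable_queueLength s)
  rw [integral_eq_lintegral_of_nonneg_ae (ae_of_all _ fun ω => Nat.cast_nonneg _)
      mQ.aestronglyMeasurable,
    integral_eq_lintegral_of_nonneg_ae (f := fun ω => workload ω s)
      (ae_of_all _ fun ω => le_max_right _ _)
      (measurable_workload s).aestronglyMeasurable, lintegral_workload hmu hs, ENNReal.toReal_mul,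
    ENNReal.toReal_ofReal (by positivity)]
  simp only [ENNReal.ofReal_natCast]
  field_simp

/-! ### The law of a day -/

section DayLaw

variable {lam : ℝ≥0} {mu : ℝ} {F : Measure ℝ}

lemma isProbabilityMeasure_dayLaw (hmu : 0 < mu) [IsProbabilityMeasure F] :
    IsProbabilityMeasure (dayLaw lam mu F) := by
  have := isProbabilityMeasure_expMeasure hmu
  unfold dayLaw
  infer_instance

lemma measurePreserving_number (hmu : 0 < mu) [IsProbabilityMeasure F] :
    MeasurePreserving (fun ω : Day => ω.1) (dayLaw lam mu F) (poissonMeasure lam) := by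
  have := isProbabilityMeasure_expMeasure hmu
  exact measurePreserving_fst

lemma measurePreserving_arrival (hmu : 0 < mu) [IsProbabilityMeasure F] (i : ℕ) :
    MeasurePreserving (fun ω : Day => ω.2.1 i) (dayLaw lam mu F) F := by
  have := isProbabilityMeasure_expMeasure hmu
  exact (measurePreserving_eval_infinitePi (fun _ : ℕ => F) i).comp
    (measurePreserving_fst.comp measurePreserving_snd)

lemma measurePreserving_service (hmu : 0 < mu) [IsProbabilityMeasure F] (i : ℕ) :
    MeasurePreserving (fun ω : Day => ω.2.2 i) (dayLaw lam mu F) (expMeasure mu) := by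
  have := isProbabilityMeasure_expMeasure hmu
  exact (measurePreserving_eval_infinitePi (fun _ : ℕ => expMeasure mu) i).comp
    (measurePreserving_snd.comp measurePreserving_snd)

lemma ae_service_pos (hmu : 0 < mu) [IsProbabilityMeasure F] :
    ∀ᵐ ω ∂(dayLaw lam mu F), ∀ k, 0 < ω.2.2 k :=
  ae_all_iff.2 fun k => (measurePreserving_service hmu k).quasiMeasurePreserving.ae
    (ae_expMeasure_pos hmu)

lemma ae_arrival_notMem (hmu : 0 < mu) [IsProbabilityMeasure F] {A : Set ℝ} (hA : F A = 0) :
    ∀ᵐ ω ∂(dayLaw lam mu F), ∀ i, ω.2.1 i ∉ A :=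
  ae_all_iff.2 fun i => (measurePreserving_arrival hmu i).quasiMeasurePreserving.ae
    (measure_eq_zero_iff_ae_notMem.1 hA)

lemma dayLaw_single_pos (hlam : 0 < lam) (hmu : 0 < mu) [IsProbabilityMeasure F] {A B : Set ℝ}
    (hA : MeasurableSet A) (hB : MeasurableSet B) (hFA : 0 < F A) (hEB : 0 < expMeasure mu B) :
    0 < dayLaw lam mu F {ω | ω.1 = 1 ∧ ω.2.1 0 ∈ A ∧ ω.2.2 0 ∈ B} := by
  have := isProbabilityMeasure_expMeasure hmu
  have hset : {ω : Day | ω.1 = 1 ∧ ω.2.1 0 ∈ A ∧ ω.2.2 0 ∈ B} =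
      ({1} : Set ℕ) ×ˢ (((fun X : ℕ → ℝ => X 0) ⁻¹' A) ×ˢ ((fun S : ℕ → ℝ => S 0) ⁻¹' B)) := by
    ext ω
    simp [Set.mem_prod]
  have h1 := (measurePreserving_eval_infinitePi (fun _ : ℕ => F) 0).measure_preimage
    hA.nullMeasurableSet
  have h2 := (measurePreserving_eval_infinitePi (fun _ : ℕ => expMeasure mu) 0).measure_preimage
    hB.nullMeasurableSet
  rw [hset, dayLaw, Measure.prod_prod, Measure.prod_prod]
  refine ENNReal.mul_pos ?_ (ENNReal.mul_pos ?_ ?_).ne'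
  · rw [poissonMeasure_singleton]
    simp only [ne_eq, ENNReal.ofReal_eq_zero, not_le]
    positivity
  · exact (h1.trans_ne hFA.ne')
  · exact (h2.trans_ne hEB.ne')

lemma memLp_number_poisson : MemLp (fun n : ℕ => (n : ℝ)) 2 (poissonMeasure lam) := by
  rw [memLp_two_iff_integrable_sq (by fun_prop), integrable_poissonMeasure_iff]
  -- From `n ≤ 2 ^ n` one gets `n ^ 2 ≤ 4 ^ n`, so an exponential series at `4λ` dominates.
  have h := (Real.summable_pow_div_factorial (4 * lam)).mul_left (Real.exp (-lam))
  refine h.of_nonneg_of_le (fun n => by positivity) fun n => ?_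
  have hn : (n : ℝ) ≤ 2 ^ n := by exact_mod_cast Nat.lt_two_pow_self.le
  have hn2 : ‖(n : ℝ) ^ 2‖ ≤ 4 ^ n := by
    rw [Real.norm_of_nonneg (by positivity)]
    calc (n : ℝ) ^ 2 ≤ (2 ^ n) ^ 2 := by gcongr
      _ = 4 ^ n := by rw [← pow_mul, mul_comm, pow_mul]; norm_num
  calc _ ≤ Real.exp (-lam) * lam ^ n / n.factorial * 4 ^ n := by gcongr
    _ = _ := by rw [mul_pow]; ring

lemma memLp_number (hmu : 0 < mu) [IsProbabilityMeasure F] :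
    MemLp (fun ω : Day => (ω.1 : ℝ)) 2 (dayLaw lam mu F) :=
  memLp_number_poisson.comp_measurePreserving (measurePreserving_number hmu)

lemma memLp_queueLength (hmu : 0 < mu) [IsProbabilityMeasure F] (s : ℝ) :
    MemLp (fun ω => (queueLength ω s : ℝ)) 2 (dayLaw lam mu F) := by
  refine (memLp_number hmu).mono ?_ (ae_of_all _ fun ω => ?_)
  · exact ((measurable_from_nat (f := fun n : ℕ => (n : ℝ))).comp
      (measurable_queueLength s)).aestronglyMeasurable
  · simpa using queueLength_le ω s

/-- The integral is at most `E N · E S`, as in Wald's identity. The sum dominates the waiting times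
at all `s ≥ 0` simultaneously. -/
lemma integrable_sum_service (hmu : 0 < mu) [IsProbabilityMeasure F] :
    Integrable (fun ω : Day => ∑ j ∈ Finset.range ω.1, ω.2.2 j) (dayLaw lam mu F) := by
  have := isProbabilityMeasure_expMeasure hmu
  have hm : Measurable fun ω : Day => ∑ j ∈ Finset.range ω.1, ω.2.2 j :=
    measurable_comp_nat (g := fun n (ω : Day) => ∑ j ∈ Finset.range n, ω.2.2 j) measurable_fst
      fun n => by fun_prop
  refine ⟨hm.aestronglyMeasurable, ?_⟩
  have hC : ∫⁻ s, ‖s‖ₑ ∂(expMeasure mu) < ∞ := by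
    have h : ∫⁻ s, ‖s‖ₑ ∂(expMeasure mu) = ∫⁻ s, ENNReal.ofReal (s - 0) ∂(expMeasure mu) := by
      refine lintegral_congr_ae ?_
      filter_upwards [ae_expMeasure_pos hmu] with s hs
      rw [sub_zero, Real.enorm_of_nonneg hs.le]
    rw [h, lintegral_expMeasure_excess hmu]
    finiteness
  have hN : ∫⁻ n : ℕ, (n : ℝ≥0∞) ∂(poissonMeasure lam) < ∞ := by
    have h := (memLp_number_poisson (lam := lam)).integrable one_le_two
    simpa [HasFiniteIntegral] using h.2
  refine lt_of_le_of_lt (b := ∫⁻ n : ℕ, (n : ℝ≥0∞) * ∫⁻ s, ‖s‖ₑ ∂(expMeasure mu)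
    ∂(poissonMeasure lam)) ?_ ?_
  · rw [dayLaw, lintegral_prod _ hm.enorm.aemeasurable]
    refine lintegral_mono fun n => ?_
    calc _ ≤ ∫⁻ p : (ℕ → ℝ) × (ℕ → ℝ), ∑ j ∈ Finset.range n, ‖p.2 j‖ₑ
          ∂((Measure.infinitePi fun _ : ℕ => F).prod
            (Measure.infinitePi fun _ : ℕ => expMeasure mu)) :=
        lintegral_mono fun p => enorm_sum_le _ _
      _ = _ := by
        rw [lintegral_finsetSum _ fun j _ => by fun_prop]
        have h : ∀ j, ∫⁻ p : (ℕ → ℝ) × (ℕ → ℝ), ‖p.2 j‖ₑ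
          ∂((Measure.infinitePi fun _ : ℕ => F).prod
            (Measure.infinitePi fun _ : ℕ => expMeasure mu)) = ∫⁻ s, ‖s‖ₑ ∂(expMeasure mu) :=
          fun j => ((measurePreserving_eval_infinitePi (fun _ : ℕ => expMeasure mu) j).comp
            measurePreserving_snd).lintegral_comp (f := fun s : ℝ => ‖s‖ₑ) (by fun_prop)
        simp [h]
  · rw [lintegral_mul_const _ (by fun_prop)]
    exact ENNReal.mul_lt_top hN hC

lemma ae_waitingTime_le (hmu : 0 < mu) [IsProbabilityMeasure F] {s : ℝ} (hs : 0 ≤ s) :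
    ∀ᵐ ω ∂(dayLaw lam mu F), ‖waitingTime ω s‖ ≤ ∑ j ∈ Finset.range ω.1, ω.2.2 j := by
  filter_upwards [ae_service_pos hmu] with ω hω
  rw [Real.norm_of_nonneg (waitingTime_nonneg ω s)]
  exact waitingTime_le ω (fun k => (hω k).le) hs

lemma integrable_waitingTime (hmu : 0 < mu) [IsProbabilityMeasure F] {s : ℝ} (hs : 0 ≤ s) :
    Integrable (fun ω => waitingTime ω s) (dayLaw lam mu F) :=
  (integrable_sum_service hmu).mono' (measurable_waitingTime s).aestronglyMeasurable
    (ae_waitingTime_le hmu hs)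

/-! ### The structure of an equilibrium -/

/-- Equal integrals would force almost sure equality, yet an atom gives positive probability to a
single customer arriving exactly at `s`. -/
lemma integral_waitingTimeLeft_lt (hlam : 0 < lam) (hmu : 0 < mu) [IsProbabilityMeasure F] {s : ℝ}
    (hs : 0 ≤ s) (hF : F {s} ≠ 0) :
    ∫ ω, waitingTimeLeft ω s ∂(dayLaw lam mu F) < ∫ ω, waitingTime ω s ∂(dayLaw lam mu F) := by
  have hW := integrable_waitingTime (lam := lam) (F := F) hmu hs
  have hle : ∀ᵐ ω ∂(dayLaw lam mu F), waitingTimeLeft ω s ≤ waitingTime ω s := by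
    filter_upwards [ae_service_pos hmu] with ω hω
    exact waitingTimeLeft_le_waitingTime ω (fun k => (hω k).le) s
  have hL : Integrable (fun ω => waitingTimeLeft ω s) (dayLaw lam mu F) := by
    refine hW.mono (measurable_waitingTimeLeft s).aestronglyMeasurable ?_
    filter_upwards [hle] with ω hω
    have h0 : 0 ≤ waitingTimeLeft ω s := le_max_right _ _
    rw [Real.norm_of_nonneg (waitingTime_nonneg ω s), Real.norm_of_nonneg h0]
    exact hω
  refine lt_of_le_of_ne (integral_mono_ae hL hW hle) fun heq => ?_
  have hae := (integral_eq_iff_of_ae_le hL hW hle).1 heq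
  have hpos := dayLaw_single_pos (F := F) hlam hmu (measurableSet_singleton s) MeasurableSet.univ
    (pos_iff_ne_zero.2 hF)
    (by have := isProbabilityMeasure_expMeasure hmu; simp)
  refine hpos.ne' (measure_mono_null (fun ω hω => ?_)
    (ae_iff.1 (hae.and (ae_service_pos hmu))))
  rintro ⟨h1, h2⟩
  have := arrivalsBefore_lt_arrivals ω (i := 0) (by rw [hω.1]; exact one_pos) hω.2.1
  exact absurd h1 (waitingTimeLeft_lt_waitingTime ω h2 this).ne

lemma tendsto_integral_waitingTime_left (hmu : 0 < mu) [IsProbabilityMeasure F] {s : ℝ}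
    (hs : 0 < s) : Tendsto (fun u => ∫ ω, waitingTime ω u ∂(dayLaw lam mu F)) (𝓝[<] s)
      (𝓝 (∫ ω, waitingTimeLeft ω s ∂(dayLaw lam mu F))) := by
  refine tendsto_integral_filter_of_dominated_convergence _
    (Eventually.of_forall fun u => (measurable_waitingTime u).aestronglyMeasurable) ?_
    (integrable_sum_service hmu) (ae_of_all _ fun ω => tendsto_waitingTime_left ω s)
  filter_upwards [Ioo_mem_nhdsLT hs] with u hu
  exact ae_waitingTime_le hmu hu.1.le

lemma mem_support_of_singleton_ne_zero {s : ℝ} (h : F {s} ≠ 0) : s ∈ F.support := by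
  rw [Measure.mem_support_iff_forall]
  intro U hU
  exact (pos_iff_ne_zero.2 h).trans_le (measure_mono (by simpa using mem_of_mem_nhds hU))

/-- An equilibrium has no atoms at positive times: it would be better to arrive just before. -/
lemma IsNashEquilibrium.measure_singleton {al be : ℝ} (hF : IsNashEquilibrium lam mu al be F)
    (hlam : 0 < lam) (hmu : 0 < mu) (hal : 0 < al) (hbe : 0 < be) {s : ℝ} (hs : 0 < s) :
    F {s} = 0 := by
  by_contra hne
  have := hF.isProbabilityMeasure
  obtain ⟨c, hc, hge⟩ := hF.exists_const
  have h1 := hc s (mem_support_of_singleton_ne_zero hne)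
  have h2 := integral_waitingTimeLeft_lt hlam hmu hs.le hne
  have h3 := tendsto_integral_waitingTime_left (lam := lam) (F := F) hmu hs
  have h4 : Tendsto (expectedCost lam mu al be F) (𝓝[<] s)
      (𝓝 (al * (∫ ω, waitingTimeLeft ω s ∂(dayLaw lam mu F)) +
        be * (s + ∫ ω, waitingTimeLeft ω s ∂(dayLaw lam mu F)))) :=
    (h3.const_mul al).add (((tendsto_id.mono_left nhdsWithin_le_nhds).add h3).const_mul be)
  -- The limiting cost from the left is at least `c`, but it is strictly below the cost at the atom,
  -- which is `c`.
  have h5 := ge_of_tendsto h4 (b := c) (by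
    filter_upwards [Ioo_mem_nhdsLT hs] with u hu using hge u hu.1.le)
  unfold expectedCost at h1
  nlinarith

lemma ae_no_tie (hmu : 0 < mu) [IsProbabilityMeasure F] {s : ℝ} (hs : F {s} = 0) :
    ∀ᵐ ω ∂(dayLaw lam mu F), waitingTime ω s = workload ω s := by
  filter_upwards [ae_arrival_notMem hmu hs] with ω hω
  exact waitingTime_of_no_tie ω (arrivals_eq_arrivalsBefore ω fun i => by simpa using hω i)

/-- On an interval of positive length without arrivals the expected waiting time is strictly
convex between the end points and the midpoint, provided that customers may arrive just before. -/
lemma integral_waitingTime_midpoint_lt (hlam : 0 < lam) (hmu : 0 < mu) [IsProbabilityMeasure F]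
    {u v : ℝ} (hu : 0 < u) (huv : u < v) (hF : F (Set.Icc u v) = 0)
    (hpos : ∀ ε > 0, 0 < F (Set.Ioc (u - ε) u)) :
    ∫ ω, waitingTime ω ((u + v) / 2) ∂(dayLaw lam mu F) <
      (∫ ω, waitingTime ω u ∂(dayLaw lam mu F) + ∫ ω, waitingTime ω v ∂(dayLaw lam mu F)) / 2 := by
  have hWu := integrable_waitingTime (lam := lam) (F := F) hmu hu.le
  have hWv := integrable_waitingTime (lam := lam) (F := F) hmu (hu.trans huv).le
  have hWm := integrable_waitingTime (lam := lam) (F := F) (s := (u + v) / 2) hmu (by linarith)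
  have hnull : ∀ s ∈ Set.Icc u v, F {s} = 0 := fun s hs =>
    measure_mono_null (Set.singleton_subset_iff.2 hs) hF
  -- Without arrivals in the gap, the waits at all three times come from one and the same departure
  -- time.
  have hrep : ∀ᵐ ω ∂(dayLaw lam mu F), ∀ s ∈ ({u, (u + v) / 2, v} : Finset ℝ),
      waitingTime ω s = max (departure ω (arrivals ω u) - s) 0 := by
    have hmem : ∀ s ∈ ({u, (u + v) / 2, v} : Finset ℝ), s ∈ Set.Icc u v := by
      intro s hs
      simp only [Finset.mem_insert, Finset.mem_singleton] at hs
      rcases hs with rfl | rfl | rfl <;> constructor <;> linarith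
    rw [eventually_all_finset]
    intro s hs
    filter_upwards [ae_no_tie hmu (hnull s (hmem s hs)), ae_arrival_notMem hmu hF] with ω h1 h2
    rw [h1, workload, arrivals_congr ω (hmem s hs).1 fun i hi => h2 i
      ⟨hi.1.le, hi.2.trans (hmem s hs).2⟩]
  rw [← integral_add hWu hWv, ← integral_div]
  have hI := (hWu.add hWv).div_const 2
  have hle : ∀ᵐ ω ∂(dayLaw lam mu F),
      waitingTime ω ((u + v) / 2) ≤ (waitingTime ω u + waitingTime ω v) / 2 := by
    filter_upwards [hrep] with ω hω
    rw [hω u (by simp), hω v (by simp), hω ((u + v) / 2) (by simp)]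
    have := le_max_left (departure ω (arrivals ω u) - u) 0
    have := le_max_right (departure ω (arrivals ω u) - u) 0
    have := le_max_left (departure ω (arrivals ω u) - v) 0
    have := le_max_right (departure ω (arrivals ω u) - v) 0
    exact max_le (by linarith) (by linarith)
  refine lt_of_le_of_ne (integral_mono_ae hWm hI hle) fun heq => ?_
  have hae := (integral_eq_iff_of_ae_le hWm hI hle).1 heq
  -- A single arrival in `(u - ε, u]` with service in `(ε, 3(v - u)/4]` departs strictly between `u`
  -- and `v`; there the positive part has its kink, and convexity is strict. The bound `ε ≤ u` keeps
  -- the arrival time nonnegative, and `ε ≤ (v - u)/2` keeps the service interval nonempty.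
  set ε := min ((v - u) / 2) u with hε
  have hε0 : 0 < ε := lt_min (by linarith) hu
  have hε1 : ε ≤ (v - u) / 2 := min_le_left _ _
  have hε2 : ε ≤ u := min_le_right _ _
  have hev := dayLaw_single_pos (F := F) (lam := lam) (A := Set.Ioc (u - ε) u)
    (B := Set.Ioc ε (3 * (v - u) / 4)) hlam hmu measurableSet_Ioc measurableSet_Ioc
    (hpos ε hε0) (expMeasure_Ioc_pos hmu hε0.le (by linarith))
  refine hev.ne' (measure_mono_null (fun ω hω => ?_)
    (ae_iff.1 (hae.and hrep)))
  rintro ⟨h1, h2⟩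
  obtain ⟨hN, hX, hS⟩ := hω
  have hA : arrivals ω u = 1 := by rw [arrivals_single hN, if_pos hX.2]
  simp only [Pi.add_apply] at h1
  rw [h2 u (by simp), h2 v (by simp), h2 ((u + v) / 2) (by simp), hA,
    departure_single hN (by linarith [hX.1])] at h1
  have hD1 : u < ω.2.1 0 + ω.2.2 0 := by linarith [hX.1, hS.1]
  have hD2 : ω.2.1 0 + ω.2.2 0 < v := by linarith [hX.2, hS.2]
  rw [max_eq_left (by linarith : 0 ≤ ω.2.1 0 + ω.2.2 0 - u),
    max_eq_right (by linarith : ω.2.1 0 + ω.2.2 0 - v ≤ 0)] at h1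
  rcases max_cases (ω.2.1 0 + ω.2.2 0 - (u + v) / 2) 0 with ⟨h3, h4⟩ | ⟨h3, h4⟩ <;>
    rw [h3] at h1 <;> linarith

/-- The support of an equilibrium in `(0, ∞)` has no gaps. -/
lemma IsNashEquilibrium.mem_support_of_mem_Icc {al be : ℝ}
    (hF : IsNashEquilibrium lam mu al be F) (hlam : 0 < lam) (hmu : 0 < mu) (hal : 0 < al)
    (hbe : 0 < be) {s x y : ℝ} (hx : x ∈ F.support) (hx0 : 0 < x) (hxs : x ≤ s)
    (hy : y ∈ F.support) (hsy : s ≤ y) : s ∈ F.support := by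
  by_contra hs
  have := hF.isProbabilityMeasure
  obtain ⟨c, hc, hge⟩ := hF.exists_const
  have hclosed : IsClosed F.support := Measure.isClosed_support
  -- The neighbours of `s` in the closed support bound a maximal gap.
  set u := sSup (F.support ∩ Set.Iic s) with hu
  set v := sInf (F.support ∩ Set.Ici s) with hv
  have hbu : BddAbove (F.support ∩ Set.Iic s) := ⟨s, fun z hz => hz.2⟩
  have hbv : BddBelow (F.support ∩ Set.Ici s) := ⟨s, fun z hz => hz.2⟩
  have hum : u ∈ F.support ∩ Set.Iic s := (hclosed.inter isClosed_Iic).csSup_mem ⟨x, hx, hxs⟩ hbu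
  have hvm : v ∈ F.support ∩ Set.Ici s := (hclosed.inter isClosed_Ici).csInf_mem ⟨y, hy, hsy⟩ hbv
  have hus : u < s := lt_of_le_of_ne hum.2 fun h => hs (h ▸ hum.1)
  have hsv : s < v := lt_of_le_of_ne hvm.2 fun h => hs (h ▸ hvm.1)
  have hu0 : 0 < u := hx0.trans_le (le_csSup hbu ⟨hx, hxs⟩)
  have hgap : Set.Ioo u v ⊆ F.supportᶜ := by
    intro z hz hzs
    rcases le_total z s with h | h
    · exact absurd (le_csSup hbu ⟨hzs, h⟩) (not_le.2 hz.1)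
    · exact absurd (csInf_le hbv ⟨hzs, h⟩) (not_le.2 hz.2)
  have hIoo : F (Set.Ioo u v) = 0 := measure_mono_null hgap Measure.measure_compl_support
  have hIcc : F (Set.Icc u v) = 0 := by
    refine measure_mono_null (t := ({u} ∪ {v}) ∪ Set.Ioo u v) (fun z hz => ?_) ?_
    · rcases eq_or_lt_of_le hz.1 with h | h
      · exact Or.inl (Or.inl h.symm)
      · rcases eq_or_lt_of_le hz.2 with h' | h'
        · exact Or.inl (Or.inr h')
        · exact Or.inr ⟨h, h'⟩
    · refine measure_union_null (measure_union_null ?_ ?_) hIoo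
      · exact hF.measure_singleton hlam hmu hal hbe hu0
      · exact hF.measure_singleton hlam hmu hal hbe (by linarith)
  have hpos : ∀ ε > 0, 0 < F (Set.Ioc (u - ε) u) := by
    intro ε hε
    have h1 : 0 < F (Set.Ioo (u - ε) v) := (Measure.mem_support_iff_forall u).1 hum.1 _
      (Ioo_mem_nhds (by linarith) (by linarith))
    have h2 : F (Set.Ioo (u - ε) v) ≤ F (Set.Ioc (u - ε) u) + F (Set.Ioo u v) := by
      refine (measure_mono fun z hz => ?_).trans (measure_union_le _ _)
      rcases le_or_gt z u with h | h
      · exact Or.inl ⟨hz.1, h⟩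
      · exact Or.inr ⟨h, hz.2⟩
    rw [hIoo, add_zero] at h2
    exact h1.trans_le h2
  have hlt := integral_waitingTime_midpoint_lt hlam hmu hu0 (hus.trans hsv) hIcc hpos
  have h1 := hc u hum.1
  have h2 := hc v hvm.1
  -- The cost is `c` at both ends and the term `be * s` is affine, so the strict inequality pushes
  -- the midpoint cost below `c`.
  have h3 := hge ((u + v) / 2) (by linarith)
  unfold expectedCost at h1 h2 h3
  nlinarith

/-- Solving the constant-cost equation for the expected wait gives slope `-be / (al + be)`; absence
of atoms identifies wait and workload. -/
lemma IsNashEquilibrium.exists_integral_queueLength {al be : ℝ}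
    (hF : IsNashEquilibrium lam mu al be F) (hlam : 0 < lam) (hmu : 0 < mu) (hal : 0 < al)
    (hbe : 0 < be) : ∃ c : ℝ, ∀ s ∈ F.support, 0 < s →
      ∫ ω, (queueLength ω s : ℝ) ∂(dayLaw lam mu F) = mu * ((c - be * s) / (al + be)) := by
  have := hF.isProbabilityMeasure
  obtain ⟨c, hc, -⟩ := hF.exists_const
  refine ⟨c, fun s hs hs0 => ?_⟩
  rw [integral_queueLength hmu hs0.le,
    ← integral_congr_ae (ae_no_tie hmu (hF.measure_singleton hlam hmu hal hbe hs0))]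
  have := hc s hs
  unfold expectedCost at this
  congr 1
  rw [eq_div_iff (by positivity)]
  linarith

/-! ### The detection of increases of the queue length -/

/-- A single customer arriving in `(s, u]` with service longer than `u` finds an empty system and is
still present at `u`. -/
lemma dayLaw_increase_pos (hlam : 0 < lam) (hmu : 0 < mu) [IsProbabilityMeasure F] {s u : ℝ}
    (hs : 0 ≤ s) (hsu : s < u) (hF : 0 < F (Set.Ioc s u)) :
    0 < dayLaw lam mu F {ω | queueLength ω s + 1 ≤ queueLength ω u} := by
  have hu : 0 ≤ u := hs.trans hsu.le
  have hev := dayLaw_single_pos (F := F) (lam := lam) (A := Set.Ioc s u)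
    (B := Set.Ioc u (u + 1)) hlam hmu measurableSet_Ioc measurableSet_Ioc hF
    (expMeasure_Ioc_pos hmu hu (by linarith))
  refine hev.trans_le (measure_mono ?_)
  rintro ω ⟨hN, hX, hS⟩
  have hX0 : 0 ≤ ω.2.1 0 := hs.trans hX.1.le
  have h1 : arrivals ω s = 0 := by rw [arrivals_single hN, if_neg (not_le.2 hX.1)]
  have h2 : arrivals ω u = 1 := by rw [arrivals_single hN, if_pos hX.2]
  have h3 : u < departure ω 1 := by
    rw [departure_single hN hX0]
    linarith [hS.1]
  simp [queueLength, h1, h2, Finset.filter_singleton, h3]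

end DayLaw

/-! ### The arrival interval -/

section Support

variable {lam : ℝ≥0} {mu al be : ℝ} {F : Measure ℝ}

lemma supportStart_le {z : ℝ} (hz : z ∈ F.support) (hz0 : 0 < z) : supportStart F ≤ z :=
  csInf_le ⟨0, fun _ hx => le_of_lt hx.2⟩ ⟨hz, hz0⟩

/-- In `ℝ` the supremum of an empty or unbounded set is `0`, so positivity rules out both. -/
lemma support_nonempty_bddAbove (h : 0 < supportEnd F) :
    (F.support ∩ Set.Ioi 0).Nonempty ∧ BddAbove (F.support ∩ Set.Ioi 0) := by
  constructor
  · by_contra hc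
    rw [Set.not_nonempty_iff_eq_empty] at hc
    simp [supportEnd, hc] at h
  · by_contra hc
    simp [supportEnd, Real.sSup_of_not_bddAbove hc] at h

lemma le_supportEnd (h : 0 < supportEnd F) {z : ℝ} (hz : z ∈ F.support) (hz0 : 0 < z) :
    z ≤ supportEnd F :=
  le_csSup (support_nonempty_bddAbove h).2 ⟨hz, hz0⟩

lemma IsNashEquilibrium.mem_support (hF : IsNashEquilibrium lam mu al be F) (hlam : 0 < lam)
    (hmu : 0 < mu) (hal : 0 < al) (hbe : 0 < be) {s : ℝ} (hs0 : 0 < s) (hs : supportStart F < s)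
    (hs' : s < supportEnd F) : s ∈ F.support := by
  obtain ⟨hne, hb⟩ := support_nonempty_bddAbove (hs0.trans hs')
  obtain ⟨x, hx, hxs⟩ := exists_lt_of_csInf_lt hne hs
  obtain ⟨y, hy, hys⟩ := exists_lt_of_lt_csSup hne hs'
  exact hF.mem_support_of_mem_Icc hlam hmu hal hbe hx.1 hx.2 hxs.le hy.1 hys.le

lemma IsNashEquilibrium.measure_Ioc_eq_zero (hF : IsNashEquilibrium lam mu al be F)
    (hlam : 0 < lam) (hmu : 0 < mu) (hal : 0 < al) (hbe : 0 < be) (hE : 0 < supportEnd F) {s u : ℝ}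
    (hs : 0 < s) (hsu : s < u) (h : u ≤ supportStart F ∨ supportEnd F ≤ s) :
    F (Set.Ioc s u) = 0 := by
  -- The right end is split off because `u` may equal `t_a` and lie in the support; it carries no
  -- atom.
  rw [← Set.Ioo_insert_right hsu, Set.insert_eq]
  refine measure_union_null (hF.measure_singleton hlam hmu hal hbe (hs.trans hsu))
    (measure_mono_null (t := F.supportᶜ) (fun z hz hzs => ?_) (Measure.measure_compl_support (μ := F)))
  rcases h with h | h
  · linarith [supportStart_le hzs (hs.trans hz.1), hz.2]
  · linarith [le_supportEnd hE hzs (hs.trans hz.1), hz.1]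

lemma IsNashEquilibrium.measure_Ioc_pos (hF : IsNashEquilibrium lam mu al be F)
    (hlam : 0 < lam) (hmu : 0 < mu) (hal : 0 < al) (hbe : 0 < be)
    (hE : supportStart F < supportEnd F) {s u : ℝ} (hs : 0 < s) (hsu : s < u)
    (hu : supportStart F < u) (hs' : s < supportEnd F) : 0 < F (Set.Ioc s u) := by
  obtain ⟨z, hz1, hz2⟩ := exists_between
    (max_lt (lt_min hsu hs') (lt_min hu hE) : max s (supportStart F) < min u (supportEnd F))
  rw [max_lt_iff] at hz1
  rw [lt_min_iff] at hz2
  have hz := hF.mem_support hlam hmu hal hbe (hs.trans hz1.1) hz1.2 hz2.2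
  exact (Measure.mem_support_iff_forall z).1 hz _ (Ioc_mem_nhds hz1.1 hz2.1)

end Support

/-! ### The index range -/

section Index

variable {F : Measure ℝ} {t : ℕ → ℝ} {m : ℕ}

lemma aLim_spec (h : ∃ i, 2 ≤ i ∧ i ≤ m ∧ supportStart F < t i) :
    2 ≤ aLim F t m ∧ aLim F t m ≤ m ∧ supportStart F < t (aLim F t m) :=
  Nat.sInf_mem (s := {i | 2 ≤ i ∧ i ≤ m ∧ supportStart F < t i}) h

lemma aLim_le {i : ℕ} (h2 : 2 ≤ i) (hm : i ≤ m) (hi : supportStart F < t i) : aLim F t m ≤ i :=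
  Nat.sInf_le ⟨h2, hm, hi⟩

lemma bLim_bddAbove : BddAbove {i | 1 ≤ i ∧ i + 1 ≤ m ∧ t i < supportEnd F} :=
  ⟨m, fun _ hi => by have := hi.2.1; omega⟩

lemma bLim_spec (h : ∃ i, 1 ≤ i ∧ i + 1 ≤ m ∧ t i < supportEnd F) :
    1 ≤ bLim F t m ∧ bLim F t m + 1 ≤ m ∧ t (bLim F t m) < supportEnd F :=
  Nat.sSup_mem (s := {i | 1 ≤ i ∧ i + 1 ≤ m ∧ t i < supportEnd F}) h bLim_bddAbove

lemma le_bLim {i : ℕ} (h1 : 1 ≤ i) (hm : i + 1 ≤ m) (hi : t i < supportEnd F) : i ≤ bLim F t m :=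
  le_csSup bLim_bddAbove ⟨h1, hm, hi⟩

lemma aLim_eq_aTilde (h1 : t 1 < supportStart F) (h : ∀ i ∈ Set.Icc 1 m, t i ≠ supportStart F) :
    aLim F t m = aTilde F t m := by
  unfold aLim aTilde
  congr 1
  ext i
  simp only [Set.mem_ofPred_eq]
  constructor
  · exact fun ⟨h2, hm, hi⟩ => ⟨by omega, hm, hi.le⟩
  · rintro ⟨h2, hm, hi⟩
    refine ⟨?_, hm, lt_of_le_of_ne hi (h i ⟨h2, hm⟩).symm⟩
    by_contra hc
    obtain rfl : i = 1 := by omega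
    linarith

lemma bLim_eq_bTilde (h1 : supportEnd F < t m) (h : ∀ i ∈ Set.Icc 1 m, t i ≠ supportEnd F) :
    bLim F t m = bTilde F t m := by
  unfold bLim bTilde
  congr 1
  ext i
  simp only [Set.mem_ofPred_eq]
  constructor
  · exact fun ⟨h2, hm, hi⟩ => ⟨h2, by omega, hi.le⟩
  · rintro ⟨h2, hm, hi⟩
    refine ⟨h2, ?_, lt_of_le_of_ne hi (h i ⟨h2, hm⟩)⟩
    by_contra hc
    obtain rfl : i = m := by omega
    linarith

/-- The estimated index range is correct as soon as an increase has been seen at both ends of the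
true range, if increases never occur outside. -/
lemma THat_eq_of_increases {n a b : ℕ} {Xi : ℕ → ℕ → ℕ} (ha : 2 ≤ a) (ham : a ≤ m) (hb : 1 ≤ b)
    (hbm : b + 1 ≤ m) (hnull_a : ∀ l, ∀ i, 2 ≤ i → i < a → Xi l i ≤ Xi l (i - 1))
    (hnull_b : ∀ l, ∀ i, b < i → i + 1 ≤ m → Xi l (i + 1) ≤ Xi l i)
    (hinc_a : ∃ l < n, Xi l (a - 1) + 1 ≤ Xi l a) (hinc_b : ∃ l < n, Xi l b + 1 ≤ Xi l (b + 1)) :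
    THat m n Xi = Finset.Icc a b := by
  have hA : aHat m n Xi = a := by
    refine le_antisymm (Nat.sInf_le ⟨ha, ham, hinc_a⟩) ?_
    obtain ⟨h2, -, l, -, hl⟩ := Nat.sInf_mem (s := {i | 2 ≤ i ∧ i ≤ m ∧ ∃ l < n,
      Xi l (i - 1) + 1 ≤ Xi l i}) ⟨a, ha, ham, hinc_a⟩
    by_contra hc
    have := hnull_a l _ h2 (not_le.1 hc)
    omega
  have hB : bHat m n Xi = b := by
    have hbdd : BddAbove {i | 1 ≤ i ∧ i + 1 ≤ m ∧ ∃ l < n, Xi l i + 1 ≤ Xi l (i + 1)} :=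
      ⟨m, fun _ hi => by have := hi.2.1; omega⟩
    refine le_antisymm ?_ (le_csSup hbdd ⟨hb, hbm, hinc_b⟩)
    obtain ⟨-, h2, l, -, hl⟩ := Nat.sSup_mem (s := {i | 1 ≤ i ∧ i + 1 ≤ m ∧ ∃ l < n,
      Xi l i + 1 ≤ Xi l (i + 1)}) ⟨b, hb, hbm, hinc_b⟩ hbdd
    by_contra hc
    have h3 : Xi l (bHat m n Xi) + 1 ≤ Xi l (bHat m n Xi + 1) := hl
    have := hnull_b l (bHat m n Xi) (not_le.1 hc) h2
    omega
  ext i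
  simp only [THat, hA, hB, Finset.mem_filter, Finset.mem_Icc]
  omega

end Index

/-! ### The estimator as a function of the data -/

section Estimator

variable {mu : ℝ} {t : ℕ → ℝ} {d : Finset ℕ → ℕ → ℕ} {m n : ℕ}

lemma THat_congr {Xi Xi' : ℕ → ℕ → ℕ} (h : ∀ l < n, ∀ i ∈ Set.Icc 1 m, Xi l i = Xi' l i) :
    THat m n Xi = THat m n Xi' := by
  have hA : aHat m n Xi = aHat m n Xi' := by
    unfold aHat
    congr 1
    ext i
    refine and_congr_right fun h2 => and_congr_right fun hm => exists_congr fun l =>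
      and_congr_right fun hl => ?_
    rw [h l hl i ⟨by omega, hm⟩, h l hl (i - 1) ⟨by omega, by omega⟩]
  have hB : bHat m n Xi = bHat m n Xi' := by
    unfold bHat
    congr 1
    ext i
    refine and_congr_right fun h2 => and_congr_right fun hm => exists_congr fun l =>
      and_congr_right fun hl => ?_
    rw [h l hl i ⟨h2, by omega⟩, h l hl (i + 1) ⟨by omega, hm⟩]
  simp only [THat, hA, hB]

lemma thetaHat_congr (hd : IsFarthestPairing t d) {Xi Xi' : ℕ → ℕ → ℕ}
    (h : ∀ l < n, ∀ i ∈ Set.Icc 1 m, Xi l i = Xi' l i) :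
    thetaHat mu t d m n Xi = thetaHat mu t d m n Xi' := by
  have hq : ∀ i ∈ THat m n Xi', qHat n Xi i = qHat n Xi' i := by
    intro i hi
    have him : i ∈ Set.Icc 1 m := by simpa using (Finset.mem_filter.1 hi).1
    unfold qHat
    rw [Finset.sum_congr rfl fun l hl => by rw [h l (Finset.mem_range.1 hl) i him]]
  unfold thetaHat
  rw [THat_congr h]
  congr 1
  refine Finset.sum_congr rfl fun i hi => ?_
  rw [pairEstimator, pairEstimator, hq i hi, hq _ (hd _ i hi).1]

lemma aemeasurable_thetaHat (hd : IsFarthestPairing t d) {Ω : Type*} [MeasurableSpace Ω]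
    {P : Measure Ω} {Xi : ℕ → ℕ → Ω → ℕ} (hXi : ∀ l i, AEMeasurable (Xi l i) P) :
    AEMeasurable (fun x => thetaHat mu t d m n fun l i => Xi l i x) P := by
  -- The estimator depends on a finite array of naturals only. Such arrays form a countable discrete
  -- space, on which every function is measurable.
  let ext : (Fin n → Fin (m + 1) → ℕ) → ℕ → ℕ → ℕ := fun v l i =>
    if h : l < n ∧ i < m + 1 then v ⟨l, h.1⟩ ⟨i, h.2⟩ else 0
  have hR : AEMeasurable (fun x => fun (l : Fin n) (i : Fin (m + 1)) => Xi l i x) P :=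
    aemeasurable_pi_lambda _ fun l => aemeasurable_pi_lambda _ fun i => hXi l i
  have hg : Measurable fun v : Fin n → Fin (m + 1) → ℕ => thetaHat mu t d m n (ext v) :=
    .of_discrete
  refine (hg.comp_aemeasurable hR).congr (ae_of_all _ fun x => ?_)
  refine thetaHat_congr hd fun l hl i hi => ?_
  have : i < m + 1 := Nat.lt_succ_of_le hi.2
  exact dif_pos (And.intro hl this)

/-- The weight collects the coefficients of `q i`: `-1/k_i` from its own pair and `1/k_j` from each
`j` paired with `i`. -/
lemma sum_gWeight_mul (hd : IsFarthestPairing t d) (T : Finset ℕ) (q : ℕ → ℝ) :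
    ∑ i ∈ T, gWeight mu t d T i * q i =
      1 / (T.card : ℝ) * ∑ i ∈ T, -((q i - q (d T i)) / (mu * (t i - t (d T i)))) := by
  have hg : ∀ i ∈ T, gWeight mu t d T i * q i =
      (∑ j ∈ T, if d T j = i then 1 / kConst mu t d T j * q i else 0) -
        1 / kConst mu t d T i * q i := by
    intro i hi
    -- The omitted term `j = i` is harmless: if `d T i = i` then `k_i = 0` and `1 / k_i` is `0` by
    -- convention.
    rw [gWeight, Finset.sum_erase, sub_mul, Finset.sum_mul]
    · congr 1
      refine Finset.sum_congr rfl fun j _ => ?_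
      split_ifs <;> simp
    · split_ifs with h
      · simp [kConst, h]
      · simp
  rw [Finset.sum_congr rfl hg, Finset.sum_sub_distrib, Finset.sum_comm, ← Finset.sum_sub_distrib,
    Finset.mul_sum]
  refine Finset.sum_congr rfl fun i hi => ?_
  rw [Finset.sum_ite_eq T (d T i) fun j => 1 / kConst mu t d T i * q j, if_pos (hd T i hi).1,
    kConst]
  simp only [div_eq_mul_inv, mul_inv]
  ring

lemma thetaHat_eq_of_THat_eq (hd : IsFarthestPairing t d) {T : Finset ℕ} {Xi : ℕ → ℕ → ℕ}
    (hT : THat m n Xi = T) : thetaHat mu t d m n Xi =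
      (∑ l ∈ Finset.range n, ∑ i ∈ T, gWeight mu t d T i * (Xi l i : ℝ)) / n := by
  rw [thetaHat, hT, Finset.sum_comm, Finset.sum_div]
  unfold pairEstimator
  rw [← sum_gWeight_mul hd T (qHat n Xi)]
  refine Finset.sum_congr rfl fun i _ => ?_
  rw [qHat, ← Finset.mul_sum, mul_div_assoc]

/-- The pair estimators are exact on linear data. -/
lemma sum_gWeight_mul_linear (hmu : 0 < mu) (hd : IsFarthestPairing t d) {T : Finset ℕ}
    (hT : 1 < T.card) (ht : Set.InjOn t T) {q : ℕ → ℝ} {c θ : ℝ}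
    (hq : ∀ i ∈ T, q i = mu * (c - θ * t i)) : ∑ i ∈ T, gWeight mu t d T i * q i = θ := by
  rw [sum_gWeight_mul hd]
  have : ∀ i ∈ T, -((q i - q (d T i)) / (mu * (t i - t (d T i)))) = θ := by
    intro i hi
    obtain ⟨hdi, hmax⟩ := hd T i hi
    -- A second point of `T` lies at positive distance, hence so does the farthest one, and the
    -- denominators do not vanish.
    obtain ⟨j, hj, hji⟩ := Finset.exists_mem_ne hT i
    have h1 : 0 < |t j - t i| := abs_pos.2 (sub_ne_zero.2 fun h => hji (ht hj hi h))
    have h2 : t (d T i) - t i ≠ 0 := abs_pos.1 (h1.trans_le (hmax j hj))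
    have h3 : t i - t (d T i) ≠ 0 := fun h => h2 (by linarith)
    rw [hq i hi, hq _ hdi]
    field_simp
    ring
  rw [Finset.sum_congr rfl this, Finset.sum_const, nsmul_eq_mul]
  have : (T.card : ℝ) ≠ 0 := by
    have : T.card ≠ 0 := by omega
    exact_mod_cast this
  field_simp

lemma sum_sum_Icc_of_symm (a b : ℕ) {f : ℕ → ℕ → ℝ} (hf : ∀ i j, f i j = f j i) :
    ∑ i ∈ Finset.Icc a b, ∑ j ∈ Finset.Icc a b, f i j =
      ∑ i ∈ Finset.Icc a b, f i i + 2 * ∑ i ∈ Finset.Icc a b, ∑ j ∈ Finset.Ioc i b, f i j := by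
  have h1 : ∀ i ∈ Finset.Icc a b, ∑ j ∈ Finset.Icc a b, f i j =
      ∑ j ∈ Finset.Ico a i, f i j + f i i + ∑ j ∈ Finset.Ioc i b, f i j := by
    intro i hi
    rw [Finset.mem_Icc] at hi
    have hu : Finset.Icc a b = (Finset.Ico a i ∪ {i}) ∪ Finset.Ioc i b := by
      ext j
      simp only [Finset.mem_Icc, Finset.mem_union, Finset.mem_Ico, Finset.mem_singleton,
        Finset.mem_Ioc]
      omega
    rw [hu, Finset.sum_union, Finset.sum_union, Finset.sum_singleton]
    · simp
    · rw [Finset.disjoint_left]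
      intro j
      simp only [Finset.mem_union, Finset.mem_Ico, Finset.mem_singleton, Finset.mem_Ioc]
      omega
  have h2 : ∑ i ∈ Finset.Icc a b, ∑ j ∈ Finset.Ico a i, f i j =
      ∑ i ∈ Finset.Icc a b, ∑ j ∈ Finset.Ioc i b, f i j := by
    rw [Finset.sum_comm' (t' := Finset.Icc a b) (s' := fun j => Finset.Ioc j b)]
    · exact Finset.sum_congr rfl fun j _ => Finset.sum_congr rfl fun i _ => hf i j
    · intro i j
      simp only [Finset.mem_Icc, Finset.mem_Ico, Finset.mem_Ioc]
      omega
  rw [Finset.sum_congr rfl h1, Finset.sum_add_distrib, Finset.sum_add_distrib, h2]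
  ring

lemma variance_sum_gWeight {lam : ℝ≥0} (hmu : 0 < mu) {F : Measure ℝ} [IsProbabilityMeasure F]
    (a b : ℕ) :
    variance (fun ω => ∑ i ∈ Finset.Icc a b, gWeight mu t d (Finset.Icc a b) i *
      (queueLength ω (t i) : ℝ)) (dayLaw lam mu F) = asymptVar lam mu F t d a b := by
  have := isProbabilityMeasure_dayLaw (lam := lam) (F := F) hmu
  have hL : ∀ i ∈ Finset.Icc a b, MemLp (fun ω => gWeight mu t d (Finset.Icc a b) i *
      (queueLength ω (t i) : ℝ)) 2 (dayLaw lam mu F) :=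
    fun i _ => (memLp_queueLength hmu (t i)).const_mul _
  have hm : AEMeasurable (fun ω => ∑ i ∈ Finset.Icc a b, gWeight mu t d (Finset.Icc a b) i *
      (queueLength ω (t i) : ℝ)) (dayLaw lam mu F) :=
    (memLp_finsetSum _ hL).aestronglyMeasurable.aemeasurable
  rw [← covariance_self hm, covariance_fun_sum_fun_sum' hL hL]
  simp only [covariance_const_mul_left, covariance_const_mul_right]
  rw [sum_sum_Icc_of_symm]
  · unfold asymptVar queueVar queueCov
    congr 1
    · refine Finset.sum_congr rfl fun i _ => ?_
      rw [covariance_self (memLp_queueLength hmu (t i)).aestronglyMeasurable.aemeasurable]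
      ring
    · congr 1
      refine Finset.sum_congr rfl fun i _ => Finset.sum_congr rfl fun j _ => ?_
      ring
  · intro i j
    rw [covariance_comm]
    ring

end Estimator

/-! ### Limits along the days -/

section Days

variable {Ω : Type*} [MeasurableSpace Ω] {P : Measure Ω} [IsProbabilityMeasure P]
  {E : Type*} [MeasurableSpace E] {ν : Measure E} {D : ℕ → Ω → E}

/-- In a sequence of independent experiments an event of positive probability occurs. -/
lemma ae_exists_mem_of_iIndepFun (hD : iIndepFun D P) (hlaw : ∀ l, HasLaw (D l) ν P) {A : Set E}
    (hA : MeasurableSet A) (hpos : 0 < ν A) : ∀ᵐ x ∂P, ∃ l, D l x ∈ A := by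
  have hν : IsProbabilityMeasure ν := (hlaw 0).isProbabilityMeasure_iff.1 inferInstance
  have hm : Measurable (A.indicator (1 : E → ℝ)) := measurable_one.indicator hA
  have hint : Integrable (A.indicator (1 : E → ℝ)) ν := (integrable_const 1).indicator hA
  -- The frequency of `A` tends to `ν A > 0`; were `A` never to occur, it would be identically `0`.
  have hlim := strong_law_ae_real (μ := P) (fun l => A.indicator (1 : E → ℝ) ∘ D l)
    (by rw [← (hlaw 0).map_eq] at hint; exact hint.comp_aemeasurable (hlaw 0).aemeasurable)
    (fun i j hij => (hD.comp _ fun _ => hm).indepFun hij)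
    (fun i => (IdentDistrib.mk (hlaw i).aemeasurable (hlaw 0).aemeasurable
      ((hlaw i).map_eq.trans (hlaw 0).map_eq.symm)).comp hm)
  filter_upwards [hlim] with x hx
  by_contra hc
  push Not at hc
  have h0 : ∀ l, (A.indicator (1 : E → ℝ) ∘ D l) x = 0 := fun l => by simp [hc l]
  simp only [h0, Finset.sum_const_zero, zero_div] at hx
  have h1 := tendsto_nhds_unique hx tendsto_const_nhds
  rw [(hlaw 0).integral_comp hm.aestronglyMeasurable, integral_indicator_one hA] at h1
  exact (ENNReal.toReal_pos hpos.ne' (measure_ne_top ν A)).ne' h1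

/-- The central limit theorem for a square integrable function of independent experiments. -/
lemma tendstoInDistribution_sqrt_mul_mean_sub (hD : iIndepFun D P) (hlaw : ∀ l, HasLaw (D l) ν P)
    {Z : E → ℝ} (hZ : Measurable Z) (hZ2 : MemLp Z 2 ν) :
    TendstoInDistribution (fun (n : ℕ) (x : Ω) =>
        √(n : ℝ) * ((∑ l ∈ Finset.range n, Z (D l x)) / n - ∫ ω, Z ω ∂ν))
      atTop (id : ℝ → ℝ) (fun _ => P) (gaussianReal 0 (variance Z ν).toNNReal) := by
  have hvar : variance (Z ∘ D 0) P = variance Z ν := by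
    rw [← covariance_self hZ.aemeasurable, ← (hlaw 0).covariance_comp hZ.aemeasurable
      hZ.aemeasurable, covariance_self (hZ.comp_aemeasurable (hlaw 0).aemeasurable)]
  have hmean : ∫ x, (Z ∘ D 0) x ∂P = ∫ ω, Z ω ∂ν := (hlaw 0).integral_comp hZ.aestronglyMeasurable
  have h := tendstoInDistribution_inv_sqrt_mul_sum_sub (P := P) (X := fun l => Z ∘ D l)
    (Y := (id : ℝ → ℝ)) (P' := gaussianReal 0 (variance Z ν).toNNReal)
    (by rw [hvar]; exact HasLaw.id)
    (by rw [← (hlaw 0).map_eq] at hZ2; exact hZ2.comp_of_map (hlaw 0).aemeasurable)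
    (hD.comp _ fun _ => hZ)
    (fun i => (IdentDistrib.mk (hlaw i).aemeasurable (hlaw 0).aemeasurable
      ((hlaw i).map_eq.trans (hlaw 0).map_eq.symm)).comp hZ)
  refine h.congr (fun n => ae_of_all _ fun x => ?_) (ae_of_all _ fun _ => rfl)
  change (√(n : ℝ))⁻¹ * (∑ k ∈ Finset.range n, Z (D k x) - n * ∫ x, (Z ∘ D 0) x ∂P) = _
  rw [hmean]
  rcases Nat.eq_zero_or_pos n with rfl | hn
  · simp
  · have hn' : (0 : ℝ) < n := by exact_mod_cast hn
    have h2 : √(n : ℝ) ≠ 0 := (Real.sqrt_pos.2 hn').ne'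
    have h3 : (n : ℝ) = √(n : ℝ) * √(n : ℝ) := (Real.mul_self_sqrt hn'.le).symm
    field_simp
    rw [pow_two, ← h3]

/-- The difference is almost surely eventually zero, hence tends to zero in measure, and Slutsky's
argument applies. -/
lemma tendstoInDistribution_of_eventually_eq {X Y : ℕ → Ω → ℝ} {ν' : Measure ℝ}
    [IsProbabilityMeasure ν'] (hX : TendstoInDistribution X atTop (id : ℝ → ℝ) (fun _ => P) ν')
    (hY : ∀ n, AEMeasurable (Y n) P) (h : ∀ᵐ x ∂P, ∀ᶠ n in atTop, Y n x = X n x) :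
    TendstoInDistribution Y atTop (id : ℝ → ℝ) (fun _ => P) ν' := by
  refine tendstoInDistribution_of_tendstoInMeasure_sub Y _ hX (tendstoInMeasure_of_tendsto_ae
    (fun n => ((hY n).sub (hX.forall_aemeasurable n)).aestronglyMeasurable) ?_) hY
  filter_upwards [h] with x hx
  refine tendsto_const_nhds.congr' ?_
  filter_upwards [hx] with n hn
  simp [hn]

end Days

end ArrivalGame

/-! ### Asymptotic normality of the estimator -/

theorem theorem2
    -- the model: arrival and service rates, cost rates, a Nash equilibrium arrival distribution
    (lam : ℝ≥0) (mu al be : ℝ) (hlam : 0 < lam) (hmu : 0 < mu) (hal : 0 < al) (hbe : 0 < be)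
    (F : Measure ℝ) (hF : IsNashEquilibrium lam mu al be F)
    -- the sampling times `0 < t 1 < … < t m`
    (m : ℕ) (t : ℕ → ℝ) (ht_pos : ∀ i ∈ Set.Icc 1 m, 0 < t i)
    (ht_mono : StrictMonoOn t (Set.Icc 1 m))
    -- two of the sampling times, neither the first nor the last, lie in `(t_a, t_b)`
    (ht_two : ∃ i j : ℕ, 2 ≤ i ∧ i < j ∧ j + 1 ≤ m ∧ supportStart F < t i ∧ t j < supportEnd F)
    -- the farthest-point pairing, with an arbitrary tie-breaking rule
    (d : Finset ℕ → ℕ → ℕ) (hd : IsFarthestPairing t d)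
    -- independent days
    {Ω : Type*} [MeasurableSpace Ω] (P : Measure Ω) [IsProbabilityMeasure P]
    (D : ℕ → Ω → Day) (hD_indep : iIndepFun D P) (hD_law : ∀ l, HasLaw (D l) (dayLaw lam mu F) P) :
    -- the queue lengths at the sampling times have finite second moments
    (∀ i ∈ Set.Icc 1 m, MemLp (fun ω => (queueLength ω (t i) : ℝ)) 2 (dayLaw lam mu F)) ∧
    -- asymptotic normality
    0 ≤ asymptVar lam mu F t d (aLim F t m) (bLim F t m) ∧
    TendstoInDistribution
      (fun (n : ℕ) (x : Ω) =>
        √(n : ℝ) * (thetaHat mu t d m n (fun l i => queueLength (D l x) (t i)) - be / (al + be)))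
      atTop (id : ℝ → ℝ) (fun _ => P)
      (gaussianReal 0 (asymptVar lam mu F t d (aLim F t m) (bLim F t m)).toNNReal) ∧
    -- on grids that reach beyond `[t_a, t_b]` and avoid its end points, the sum runs over all
    -- sampling times in the support
    (t 1 < supportStart F → supportEnd F < t m →
      (∀ i ∈ Set.Icc 1 m, t i ≠ supportStart F ∧ t i ≠ supportEnd F) →
      aLim F t m = aTilde F t m ∧ bLim F t m = bTilde F t m) := by
  have hFp := hF.isProbabilityMeasure
  have hdl := isProbabilityMeasure_dayLaw (lam := lam) (F := F) hmu
  obtain ⟨i₀, j₀, hi2, hij, hjm, hti, htj⟩ := ht_two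
  have hlt : ∀ i j, 1 ≤ i → i < j → j ≤ m → t i < t j := fun i j hi hij hj =>
    ht_mono ⟨hi, by omega⟩ ⟨by omega, hj⟩ hij
  obtain ⟨ha2, ham, hta⟩ := aLim_spec (F := F) (t := t) (m := m) ⟨i₀, hi2, by omega, hti⟩
  obtain ⟨hb1, hbm, htb⟩ := bLim_spec (F := F) (t := t) (m := m) ⟨j₀, by omega, hjm, htj⟩
  have hai : aLim F t m ≤ i₀ := aLim_le hi2 (by omega) hti
  have hjb : j₀ ≤ bLim F t m := le_bLim (by omega) hjm htj
  have hE0 : 0 < supportEnd F := (ht_pos j₀ ⟨by omega, by omega⟩).trans htj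
  have hSE : supportStart F < supportEnd F :=
    hti.trans ((hlt i₀ j₀ (by omega) hij (by omega)).trans htj)
  -- By extremality of `a` and `b`, the remaining sampling times that matter lie at or beyond the
  -- ends of the arrival interval.
  have hta' := fun i (hi : i < aLim F t m) (h2 : 2 ≤ i) =>
    not_lt.1 fun h => absurd (aLim_le h2 (by omega) h) (not_le.2 hi)
  have htb' := fun i (hi : bLim F t m < i) (h1 : i + 1 ≤ m) =>
    not_lt.1 fun h => absurd (le_bLim (by omega) h1 h) (not_le.2 hi)
  set a := aLim F t m with ha_def
  set b := bLim F t m with hb_def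
  -- no increases outside the index range
  have hnull : ∀ᵐ x ∂P, ∀ l, ∀ i, 1 ≤ i → i + 1 ≤ m → (i + 1 < a ∨ b < i) →
      queueLength (D l x) (t (i + 1)) ≤ queueLength (D l x) (t i) := by
    refine ae_all_iff.2 fun l => ae_all_iff.2 fun i => ?_
    simp only [eventually_imp_distrib_left]
    intro h1 hm hab
    have hti1 := hlt i (i + 1) h1 (by omega) hm
    have hF0 := hF.measure_Ioc_eq_zero hlam hmu hal hbe hE0 (ht_pos i ⟨h1, by omega⟩) hti1
      (hab.imp (fun h => hta' _ h (by omega)) fun h => htb' _ h hm)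
    refine ae_of_ae_map (hD_law l).aemeasurable
      (p := fun ω => queueLength ω (t (i + 1)) ≤ queueLength ω (t i)) ?_
    rw [(hD_law l).map_eq]
    filter_upwards [ae_arrival_notMem hmu hF0] with ω hω
    exact queueLength_anti ω hti1.le hω
  -- increases at both ends of the index range
  have hinc : ∀ i, 1 ≤ i → i + 1 ≤ m → supportStart F < t (i + 1) → t i < supportEnd F →
      ∀ᵐ x ∂P, ∃ l, queueLength (D l x) (t i) + 1 ≤ queueLength (D l x) (t (i + 1)) := by
    intro i h1 hm hs he
    have h0 := ht_pos i ⟨h1, by omega⟩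
    have hti1 := hlt i (i + 1) h1 (by omega) hm
    exact ae_exists_mem_of_iIndepFun hD_indep hD_law
      (A := {ω | queueLength ω (t i) + 1 ≤ queueLength ω (t (i + 1))})
      (measurableSet_le ((measurable_queueLength _).add_const 1) (measurable_queueLength _))
      (dayLaw_increase_pos hlam hmu h0.le hti1
        (hF.measure_Ioc_pos hlam hmu hal hbe hSE h0 hti1 hs he))
  -- Here `t (a - 1) < t_b` because `a ≤ i₀ < j₀`; symmetrically, `t (b + 1) > t_a` below.
  have hinc_a := hinc (a - 1) (by omega) (by omega) (by rwa [Nat.sub_add_cancel (by omega)])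
    ((hlt (a - 1) j₀ (by omega) (by omega) (by omega)).trans htj)
  have hinc_b := hinc b hb1 hbm
    (hti.trans (hlt i₀ (b + 1) (by omega) (by omega) (by omega))) htb
  have hT : ∀ᵐ x ∂P, ∀ᶠ n in atTop,
      THat m n (fun l i => queueLength (D l x) (t i)) = Finset.Icc a b := by
    filter_upwards [hnull, hinc_a, hinc_b] with x h0 ⟨la, hla⟩ ⟨lb, hlb⟩
    rw [Nat.sub_add_cancel (by omega)] at hla
    -- Once both witnessing days have been observed, the range no longer changes.
    filter_upwards [eventually_gt_atTop la, eventually_gt_atTop lb] with n hna hnb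
    refine THat_eq_of_increases ha2 ham hb1 hbm (fun l i h2 hia => ?_)
      (fun l i hbi him => h0 l i (by omega) him (Or.inr hbi)) ⟨la, hna, hla⟩ ⟨lb, hnb, hlb⟩
    have := h0 l (i - 1) (by omega) (by omega) (Or.inl (by omega))
    rwa [Nat.sub_add_cancel (by omega)] at this
  -- the limiting linear statistic
  set Z : Day → ℝ := fun ω => ∑ i ∈ Finset.Icc a b,
    gWeight mu t d (Finset.Icc a b) i * (queueLength ω (t i) : ℝ) with hZ_def
  have hQm : ∀ i, Measurable fun ω => (queueLength ω (t i) : ℝ) := fun i =>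
    (measurable_from_nat (f := fun n : ℕ => (n : ℝ))).comp (measurable_queueLength (t i))
  have hQ2 : ∀ i, MemLp (fun ω => (queueLength ω (t i) : ℝ)) 2 (dayLaw lam mu F) := fun i =>
    memLp_queueLength hmu (t i)
  have hZm : Measurable Z := Finset.measurable_fun_sum _ fun i _ => (hQm i).const_mul _
  have hZ2 : MemLp Z 2 (dayLaw lam mu F) := memLp_finsetSum _ fun i _ => (hQ2 i).const_mul _
  have hZvar : variance Z (dayLaw lam mu F) = asymptVar lam mu F t d a b :=
    variance_sum_gWeight hmu a b
  -- All sampling times with index in `{a, …, b}` are interior to the arrival interval, where the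
  -- mean is affine and the weights return its slope.
  have hZmean : ∫ ω, Z ω ∂(dayLaw lam mu F) = be / (al + be) := by
    obtain ⟨c, hc⟩ := hF.exists_integral_queueLength hlam hmu hal hbe
    rw [integral_finsetSum _ fun i _ => ((hQ2 i).integrable one_le_two).const_mul _]
    simp only [integral_const_mul]
    refine sum_gWeight_mul_linear (c := c / (al + be)) hmu hd (by rw [Nat.card_Icc]; omega) ?_
      fun i hi => ?_
    · refine ht_mono.injOn.mono fun i hi => ?_
      rw [Finset.coe_Icc] at hi
      exact ⟨by linarith [hi.1], by linarith [hi.2]⟩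
    · rw [Finset.mem_Icc] at hi
      have hi0 := ht_pos i ⟨by omega, by omega⟩
      have h1 : supportStart F < t i :=
        hta.trans_le (ht_mono.monotoneOn ⟨by omega, by omega⟩ ⟨by omega, by omega⟩ hi.1)
      have h2 : t i < supportEnd F :=
        (ht_mono.monotoneOn ⟨by omega, by omega⟩ ⟨by omega, by omega⟩ hi.2).trans_lt htb
      rw [hc _ (hF.mem_support hlam hmu hal hbe hi0 h1 h2) hi0]
      ring
  refine ⟨fun i _ => hQ2 i, hZvar ▸ variance_nonneg _ _, ?_, fun h1 h2 h3 =>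
    ⟨aLim_eq_aTilde h1 fun i hi => (h3 i hi).1, bLim_eq_bTilde h2 fun i hi => (h3 i hi).2⟩⟩
  have hclt := tendstoInDistribution_sqrt_mul_mean_sub hD_indep hD_law hZm hZ2
  simp only [hZmean, hZvar] at hclt
  refine tendstoInDistribution_of_eventually_eq hclt (fun n => ?_) ?_
  · exact ((aemeasurable_thetaHat hd fun l i =>
      (measurable_queueLength (t i)).comp_aemeasurable (hD_law l).aemeasurable).sub_const
        _).const_mul _
  · filter_upwards [hT] with x hx
    filter_upwards [hx] with n hn
    rw [thetaHat_eq_of_THat_eq hd hn]
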